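/- Let $\mathcal X$ be a domain (a measurable space in which points are measurable) and let $\mathcal H$ be a class of functions $\mathcal X\to\{0,1\}$. A set $T\subseteq\mathcal X$ is shattered by $\mathcal H$ if every labelling $T\to\{0,1\}$ is the restriction to $T$ of some $h\in\mathcal H$. For $S\subseteq\mathcal X$, let $\mathsf{VC}_S(\mathcal H)$ be the largest $k$ such that some $T\subseteq S$ with $|T|=k$ is shattered by $\mathcal H$, and let $\mathsf{LVC}_S(\mathcal H)$ be the largest $k\le |S|$ such that every $T\subseteq S$ with $|T|=k$ is shattered by $\mathcal H$. For a probability distribution $\mathcal D$ on $\mathcal X$ and a (measurable) function $f:\mathcal X\to\{0,1\}$, put $\mathsf{dist}_{\mathcal D}(f,\mathcal H)=\inf_{h\in\mathcal H}\Pr_{x\sim\mathcal D}[f(x)\ne h(x)]$. For $0\le\epsilon_0<\epsilon_1$, an adaptive $(\epsilon_0,\epsilon_1)$-tolerant distribution-free tester for $\mathcal H$ with query complexity $q$ is a randomized algorithm that, for any unknown distribution $\mathcal D$ and function $f:\mathcal X\to\{0,1\}$, at each step either queries $f(x)$ at a point $x$ of its choice or receives a sample $(x,f(x))$ with a fresh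 $x\sim\mathcal D$, each step depending on everything seen before, with at most $q$ queries and samples in total. It must output $1$ with probability at least $2/3$ whenever $\mathsf{dist}_{\mathcal D}(f,\mathcal H)\le\epsilon_0$, and $0$ with probability at least $2/3$ whenever $\mathsf{dist}_{\mathcal D}(f,\mathcal H)\ge\epsilon_1$. Let $q^{\mathsf{tol}}_{\epsilon_0,\epsilon_1}(\mathcal H)$ be the minimum $q$ for which such a tester exists ($\infty$ if there is none). **Theorem.** There are absolute constants $C,c,\epsilon^*>0$ such that the following holds for every domain $\mathcal X$, every class $\mathcal H$ of functions $\mathcal X\to\{0,1\}$ and every $S\subseteq\mathcal X$. If $\mathsf{VC}_S(\mathcal H)\ge 2$, $|S|>5\,\mathsf{VC}_S(\mathcal H)$ (in particular $\mathsf{VC}_S(\mathcal H)$ is finite) and $$\mathsf{LVC}_S(\mathcal H)\ \ge\ C\cdot\mathsf{VC}_S(\mathcal H)^{3/4}\sqrt{\log\mathsf{VC}_S(\mathcal H)},$$ then for all $0<\epsilon_1\le\epsilon^*$ and all $0\le\epsilon_0<\epsilon_1$ (including $\epsilon_0=0$), $$q^{\mathsf{tol}}_{\epsilon_0,\epsilon_1}(\mathcal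 H)\ \ge\ c\cdot\frac{\mathsf{LVC}_S(\mathcal H)^2}{\mathsf{VC}_S(\mathcal H)\,\log\mathsf{VC}_S(\mathcal H)}.$$ -/

import Mathlib

open MeasureTheory
open scoped ENNReal

universe u v

/-- A set `T` of points is shattered by the class `H` if every labelling of `T` is the restriction
of some function in `H`. -/
def Shatters {X : Type u} (H : Set (X → Bool)) (T : Set X) : Prop :=
  ∀ l : T → Bool, ∃ h ∈ H, ∀ x : T, h x = l x

/-- The VC dimension of `H` with respect to `S`: the largest size of a shattered subset of `S`
(`⊤` if there are arbitrarily large ones). -/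
noncomputable def vcDim {X : Type u} (H : Set (X → Bool)) (S : Set X) : ℕ∞ :=
  sSup {k : ℕ∞ | ∃ T : Set X, T ⊆ S ∧ T.encard = k ∧ Shatters H T}

/-- The LVC dimension of `H` with respect to `S`: the largest `k` such that all subsets of `S` of
size `k` are shattered. The bound `k ≤ |S|` excludes the values of `k` for which `S` has no subset
of size `k` at all. -/
noncomputable def lvcDim {X : Type u} (H : Set (X → Bool)) (S : Set X) : ℕ∞ :=
  sSup {k : ℕ∞ | k ≤ S.encard ∧ ∀ T : Set X, T ⊆ S → T.encard = k → Shatters H T}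

/-- The distance of `f` to the class `H` under `D`: the infimum over `h ∈ H` of the probability
that `f` and `h` differ (it is `⊤` if `H` is empty). -/
noncomputable def distToClass {X : Type u} [MeasurableSpace X] (D : Measure X) (f : X → Bool)
    (H : Set (X → Bool)) : ℝ≥0∞ :=
  ⨅ h ∈ H, D {x | f x ≠ h x}

/-- A deterministic adaptive algorithm that sees at most `q` values of the unknown function. At each
step it halts with an output bit, or queries a point `x` of its choice and goes on according to the
label of `x`, or asks for a random sample and goes on according to the point received and its
label. -/
inductive DecisionTree (X : Type u) : ℕ → Type u
  | output {q : ℕ} (b : Bool) : DecisionTree X q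
  | query {q : ℕ} (x : X) (next : Bool → DecisionTree X q) : DecisionTree X (q + 1)
  | sample {q : ℕ} (next : X → Bool → DecisionTree X q) : DecisionTree X (q + 1)

/-- The output of a decision tree on the function `f`, where `s i` is the point that is delivered if
step `i` asks for a sample (it is discarded if step `i` makes a query or is not reached). -/
def DecisionTree.eval {X : Type u} (f : X → Bool) : {q : ℕ} → DecisionTree X q → (Fin q → X) → Bool
  | _, .output b, _ => b
  | _, .query x next, s => (next (f x)).eval f (fun i => s i.succ)
  | _, .sample next, s => (next (s 0) (f (s 0))).eval f (fun i => s i.succ)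

/-- A randomized adaptive algorithm that sees at most `q` values of the unknown function: it draws
a random seed from some probability space and runs the decision tree given by the seed. -/
structure RandomizedAlgorithm (X : Type u) (q : ℕ) where
  Seed : Type v
  [measurableSpaceSeed : MeasurableSpace Seed]
  law : Measure Seed
  [isProbabilityMeasure_law : IsProbabilityMeasure law]
  tree : Seed → DecisionTree X q

attribute [instance] RandomizedAlgorithm.measurableSpaceSeed
  RandomizedAlgorithm.isProbabilityMeasure_law

namespace RandomizedAlgorithm

variable {X : Type u} {q : ℕ}

/-- The event, in the space of seeds and of sample sequences, that the output on `f` is `b`. -/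
def outputEvent (A : RandomizedAlgorithm.{u, v} X q) (f : X → Bool) (b : Bool) :
    Set (A.Seed × (Fin q → X)) :=
  {z | (A.tree z.1).eval f z.2 = b}

/-- The joint law of the seed and of `q` independent samples from `D`. -/
noncomputable def jointLaw [MeasurableSpace X] (A : RandomizedAlgorithm.{u, v} X q)
    (D : Measure X) : Measure (A.Seed × (Fin q → X)) :=
  A.law.prod (Measure.pi fun _ : Fin q => D)

/-- `A` is an `(ε₀, ε₁)`-tolerant distribution-free tester for `H`: for every distribution `D` and
every function `f`, the output of `A` is a random variable, it is `1` with probability at least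
`2/3` if `f` is `ε₀`-close to `H` under `D`, and it is `0` with probability at least `2/3` if `f`
is `ε₁`-far from `H` under `D`. -/
def IsTolerantTester [MeasurableSpace X] (A : RandomizedAlgorithm.{u, v} X q)
    (H : Set (X → Bool)) (ε₀ ε₁ : ℝ) : Prop :=
  ∀ D : Measure X, IsProbabilityMeasure D → ∀ f : X → Bool, Measurable f →
    (∀ b : Bool, NullMeasurableSet (A.outputEvent f b) (A.jointLaw D)) ∧
    (distToClass D f H ≤ ENNReal.ofReal ε₀ → 2 / 3 ≤ A.jointLaw D (A.outputEvent f true)) ∧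
    (ENNReal.ofReal ε₁ ≤ distToClass D f H → 2 / 3 ≤ A.jointLaw D (A.outputEvent f false))

end RandomizedAlgorithm

/-- The least number `q` of queries and samples with which `H` can be `(ε₀, ε₁)`-tested (`⊤` if
there is no tester). -/
noncomputable def qTol {X : Type u} [MeasurableSpace X] (H : Set (X → Bool)) (ε₀ ε₁ : ℝ) : ℕ∞ :=
  sInf {n : ℕ∞ | ∃ q : ℕ, n = q ∧
    ∃ A : RandomizedAlgorithm.{u, v} X q, A.IsTolerantTester H ε₀ ε₁}

/-! The hardness lies in the distribution, not in the function. Write `d` for the VC dimension and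
`l` for the LVC dimension on `S`. By Sauer–Shelah and a volume count, some labelling of `5 * d`
points of `S` disagrees with every `h ∈ H` on more than `d / 200` of them (`exists_labelling_far`).
Fix it as `f`: queries then have known answers, and the tester only sees samples from a law on these
points and one spare point (`exists_sample_test`).

Give the points independent random weights. If fewer than `l` weights are nonzero, the support has
at most `l` points, is shattered, and the distance is `0`, so every `ε₀ ≥ 0` is covered. If all
weights are at least of order `1 / d` and their sum is below `1 / 2`, the distance is at least a
constant. So the tester must tell small support from large support.

As in support-size lower bounds, two priors on a weight, one mostly at `0` and one bounded away from
`0`, share their moments up to order `m + 1`, with `m` of order `log d` (`exists_moment_matching`).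
Their values are at most `y`, of order `m ^ 2 / l`. The probability of accepting is a polynomial of
degree at most `q` in each weight, and its terms above the matched order contribute little when `y *
q ≲ m`. Exchanging the priors one coordinate at a time loses only a factor `5 * d`, absorbed by `exp
(-m)` (`abs_prodExpect_firstSuccess_sub_le`, `moment_error_le`).

Hence `q ≳ l / log d`, which dominates `l ^ 2 / (d * log d)` because `l ≤ d`. The lower bound on `l`
secures `m ^ 2 ≲ l`, so that the weights are probabilities. -/

/-! ### Moment-matched priors -/

open Finset in
/-- The alternating binomial sum of a low power of the distance to the centre vanishes. -/
theorem sum_alternating_choose_mul_sub_pow_eq_zero (m r : ℕ) (hr : r < 2 * m) :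
    ∑ i ∈ range (2 * m + 1),
      (-1 : ℝ) ^ i * ((2 * m).choose i : ℝ) * ((i : ℝ) - m) ^ r = 0 := by
  -- The sum is the forward difference of order `2 * m` of `t ↦ t ^ r` at `-m`; the order is even,
  -- so the signs agree.
  have h := congrFun (fwdDiff_iter_pow_eq_zero_of_lt (R := ℝ) hr) (-(m : ℝ))
  rw [fwdDiff_iter_eq_sum_shift] at h
  refine (sum_congr rfl fun i hi => ?_).trans h
  have hi' : i ≤ 2 * m := by have := mem_range.1 hi; omega
  have hs : (-1 : ℝ) ^ (2 * m - i) = (-1) ^ i := by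
    have h1 : (-1 : ℝ) ^ (2 * m - i) * (-1) ^ i = 1 := by
      rw [← pow_add, Nat.sub_add_cancel hi', pow_mul]; norm_num
    have h2 : (-1 : ℝ) ^ i * (-1) ^ i = 1 := by
      rw [← pow_add, ← two_mul, pow_mul]; norm_num
    calc (-1 : ℝ) ^ (2 * m - i) = (-1 : ℝ) ^ (2 * m - i) * ((-1) ^ i * (-1) ^ i) := by
          rw [h2, mul_one]
      _ = (-1) ^ i := by rw [← mul_assoc, h1, one_mul]
  simp only [zsmul_eq_mul, nsmul_eq_mul, mul_one]
  push_cast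
  rw [hs]
  ring

open Finset in
theorem sum_inv_succ_sq_le (m : ℕ) :
    ∑ j ∈ range m, 1 / ((j : ℝ) + 1) ^ 2 ≤ 2 - 2 / ((m : ℝ) + 1) := by
  induction m with
  | zero => simp
  | succ m ih =>
    rw [sum_range_succ]
    have h : 1 / ((m : ℝ) + 1) ^ 2 ≤ 2 / ((m : ℝ) + 1) - 2 / ((m : ℝ) + 1 + 1) := by
      have hm : (0 : ℝ) ≤ m := m.cast_nonneg
      rw [div_sub_div _ _ (by positivity) (by positivity), div_le_div_iff₀ (by positivity)
        (by positivity)]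
      nlinarith [mul_nonneg hm hm, mul_nonneg (mul_nonneg hm hm) hm]
    push_cast
    linarith

open Finset in
theorem sum_inv_sub_sq_le (m : ℕ) :
    ∑ i ∈ range (2 * m + 1), 1 / ((i : ℝ) - m) ^ 2 ≤ 4 := by
  have h2 : ∑ j ∈ range m, 1 / ((j : ℝ) + 1) ^ 2 ≤ 2 :=
    (sum_inv_succ_sq_le m).trans (by have : 0 ≤ 2 / ((m : ℝ) + 1) := by positivity
                                     linarith)
  have e : 2 * m + 1 = m + (m + 1) := by ring
  rw [e, sum_range_add, sum_range_succ']
  have e1 : ∑ i ∈ range m, 1 / ((i : ℝ) - m) ^ 2 = ∑ j ∈ range m, 1 / ((j : ℝ) + 1) ^ 2 := by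
    rw [← sum_range_reflect]
    refine sum_congr rfl fun j hj => ?_
    have hj' := mem_range.1 hj
    have : ((m - 1 - j : ℕ) : ℝ) = m - 1 - j := by
      rw [Nat.cast_sub (by omega), Nat.cast_sub (by omega)]; simp
    rw [this]
    congr 1
    ring
  rw [e1]
  have e2 : ∑ k ∈ range m, 1 / (((m + (k + 1) : ℕ) : ℝ) - m) ^ 2
      = ∑ j ∈ range m, 1 / ((j : ℝ) + 1) ^ 2 :=
    sum_congr rfl fun j _ => by push_cast; congr 1; ring
  rw [e2]
  simp
  norm_num at h2
  linarith

/-- A finitely supported real signed measure of total mass zero whose weights `w` kill the monomials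
`v ^ k` for `k < L` splits into two probability vectors with equal moments. -/
theorem exists_probability_split {J : Type} [Fintype J] (v w : J → ℝ) (L : ℕ)
    (hL : 0 < L) (hw : ∀ k < L, ∑ j, w j * v j ^ k = 0) (j₀ : J) (h1 : 1 ≤ w j₀) :
    ∃ W : ℝ, 1 ≤ W ∧ ∑ j, max (w j) 0 / W = 1 ∧ ∑ j, max (-w j) 0 / W = 1 ∧
      ∀ k < L, ∑ j, max (w j) 0 / W * v j ^ k = ∑ j, max (-w j) 0 / W * v j ^ k := by
  have hsub : ∀ j, max (w j) 0 - max (-w j) 0 = w j := fun j => by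
    rcases le_total (w j) 0 with h | h
    · rw [max_eq_right h, max_eq_left (by linarith)]; ring
    · rw [max_eq_left h, max_eq_right (by linarith)]; ring
  have hW : ∑ j, max (w j) 0 = ∑ j, max (-w j) 0 := by
    rw [← sub_eq_zero, ← Finset.sum_sub_distrib]
    simpa [hsub] using hw 0 hL
  have hW1 : 1 ≤ ∑ j, max (w j) 0 :=
    (h1.trans (le_max_left _ _)).trans
      (Finset.single_le_sum (f := fun j => max (w j) 0) (fun j _ => le_max_right _ _)
        (Finset.mem_univ j₀))
  refine ⟨∑ j, max (w j) 0, hW1, ?_, ?_, fun k hk => ?_⟩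
  · rw [← Finset.sum_div]; exact div_self (by linarith)
  · rw [← Finset.sum_div, ← hW]; exact div_self (by linarith)
  · rw [← sub_eq_zero, ← Finset.sum_sub_distrib]
    calc _ = ∑ j, (w j * v j ^ k) / (∑ j, max (w j) 0) := by
          refine Finset.sum_congr rfl fun j _ => ?_
          rw [← sub_mul, ← sub_div, hsub]; ring
      _ = 0 := by rw [← Finset.sum_div, hw k hk, zero_div]

open Finset in
/-- Two finitely supported priors on `[0, 32 b m²]` with the same moments up to order `m + 1` and
with bounded mean, the first of which is concentrated at `0` and the second is supported in
`[1, ∞)`. -/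
theorem exists_moment_matching (m : ℕ) (hm : 1 ≤ m) (b : ℝ) (hb : 2 ≤ b) :
    ∃ (J : Type) (_ : Fintype J) (v a a' : J → ℝ),
      (∀ j, 0 ≤ a j) ∧ (∀ j, 0 ≤ a' j) ∧ ∑ j, a j = 1 ∧ ∑ j, a' j = 1 ∧
      (∀ j, 0 ≤ v j) ∧ (∀ j, v j ≤ 32 * b * m ^ 2) ∧
      (∀ k < m + 2, ∑ j, a j * v j ^ k = ∑ j, a' j * v j ^ k) ∧
      (∀ j, a' j ≠ 0 → 1 ≤ v j) ∧
      ∑ j, a j * (if v j = 0 then 0 else 1) ≤ 5 / b ∧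
      ∑ j, a' j * v j ≤ 3 / 2 := by
  set z : ℕ → ℝ := fun i => (i : ℝ) - m with hz
  -- Quadratically spaced nodes: about `m` moments are matched on an interval of length of order `m
  -- ^ 2`. The factor `32` makes the total first absolute moment of the weights at most `1 / 2`.
  set c : ℝ := 32 * b with hc
  set x : ℕ → ℝ := fun i => c * z i ^ 2 with hx
  set ν : ℕ → ℝ := fun i =>
    (-1) ^ m * ((-1) ^ i * ((2 * m).choose i : ℝ)) / ((2 * m).choose m : ℝ) with hν
  have hcb : (0 : ℝ) < ((2 * m).choose m : ℝ) := by
    exact_mod_cast Nat.choose_pos (by omega)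
  have hν1 : ∀ i, |ν i| ≤ 1 := fun i => by
    simp only [hν, abs_div, abs_mul, abs_pow, abs_neg, abs_one, one_pow, one_mul, Nat.abs_cast]
    rw [div_le_one hcb]
    exact_mod_cast Nat.choose_le_centralBinom i m
  have hνm : ν m = 1 := by
    simp only [hν]
    rw [← mul_assoc, ← pow_add, ← two_mul, pow_mul]
    simp [hcb.ne']
  have hνx : ∀ k < m, ∑ i ∈ range (2 * m + 1), ν i * x i ^ k = 0 := fun k hk => by
    have h := sum_alternating_choose_mul_sub_pow_eq_zero m (2 * k) (by omega)
    calc _ = ∑ i ∈ range (2 * m + 1), ((-1) ^ m / ((2 * m).choose m : ℝ) * c ^ k) *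
          ((-1 : ℝ) ^ i * ((2 * m).choose i : ℝ) * ((i : ℝ) - m) ^ (2 * k)) := by
            refine sum_congr rfl fun i _ => ?_
            simp only [hν, hx, hz, mul_pow, pow_mul]
            ring
      _ = 0 := by rw [← mul_sum, h, mul_zero]
  have hz1 : ∀ i, i ≠ m → 1 ≤ z i ^ 2 := fun i hi => by
    have : (1 : ℤ) ≤ ((i : ℤ) - m) ^ 2 := by
      have : (i : ℤ) - m ≠ 0 := by omega
      have := sq_pos_of_ne_zero this
      omega
    simp only [hz]
    exact_mod_cast this
  have hzle : ∀ i ∈ range (2 * m + 1), z i ^ 2 ≤ (m : ℝ) ^ 2 := fun i hi => by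
    have h1 : (i : ℝ) ≤ 2 * m := by
      have := mem_range.1 hi
      exact_mod_cast (by omega : i ≤ 2 * m)
    apply sq_le_sq'
    · simp [hz]
    · simp only [hz]; linarith
  have hzm : z m = 0 := by simp [hz]
  have hxm : x m = 0 := by simp [hx, hzm]
  have hxc : ∀ i, i ≠ m → c ≤ x i := fun i hi => by
    simp only [hx]
    nlinarith [hz1 i hi]
  -- Dividing by `(x - 1) * (x - b)` makes the weights away from `0` summably small and leaves room
  -- for atoms at `1` and `b`, which recover two further moments. The factor `b` normalises the
  -- weight at `0` to `1`.
  set w : ℕ → ℝ := fun i => ν i * b / ((x i - 1) * (x i - b)) with hw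
  have hwm : w m = 1 := by
    have hb0 : b ≠ 0 := by linarith
    simp only [hw, hνm, hxm]
    rw [div_eq_one_iff_eq (mul_ne_zero (by norm_num) (by simpa using hb0))]
    ring
  have hden : ∀ i, (x i - 1) * (x i - b) ≠ 0 := fun i => by
    by_cases hi : i = m
    · rw [hi, hxm]; apply mul_ne_zero <;> linarith
    · have := hxc i hi
      apply mul_ne_zero <;> linarith
  have hwx : ∀ i, |w i * x i| ≤ 1 / 8 * (1 / z i ^ 2) := fun i => by
    by_cases hi : i = m
    -- At the centre both sides vanish, since `1 / 0 = 0`.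
    · rw [hi, hxm, hzm]; simp
    have h1 := hxc i hi
    have h2 := hz1 i hi
    have hd : x i ^ 2 / 4 ≤ (x i - 1) * (x i - b) := by nlinarith
    have hxp : 0 < x i := by linarith
    have hdp : 0 < (x i - 1) * (x i - b) := lt_of_lt_of_le (by positivity) hd
    rw [abs_mul, hw]
    simp only [abs_div, abs_mul]
    rw [← abs_mul (x i - 1), abs_of_pos hdp, abs_of_pos hxp, abs_of_pos (by linarith : 0 < b)]
    calc |ν i| * b / ((x i - 1) * (x i - b)) * x i ≤ 1 * b / (x i ^ 2 / 4) * x i := by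
          gcongr
          exact hν1 i
      _ = 4 * b / x i := by field_simp
      _ = 1 / 8 * (1 / z i ^ 2) := by
          simp only [hx, hc]
          field_simp
          norm_num
  have hwx' : ∑ i ∈ range (2 * m + 1), |w i * x i| ≤ 1 / 2 := by
    calc _ ≤ ∑ i ∈ range (2 * m + 1), 1 / 8 * (1 / z i ^ 2) := sum_le_sum fun i _ => hwx i
      _ ≤ 1 / 2 := by
        rw [← mul_sum]
        have := sum_inv_sub_sq_le m
        linarith
  have hws : ∑ i ∈ (range (2 * m + 1)).erase m, |w i| ≤ 1 / b := by
    calc _ ≤ ∑ i ∈ (range (2 * m + 1)).erase m, |w i * x i| / c := by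
          refine sum_le_sum fun i hi => ?_
          have := hxc i (ne_of_mem_erase hi)
          have hc0 : 0 < c := by linarith
          rw [le_div_iff₀ hc0, abs_mul, abs_of_pos (a := x i) (by linarith)]
          gcongr
      _ ≤ (1 / 2) / c := by
          rw [← sum_div]
          gcongr
          exact (sum_le_sum_of_subset_of_nonneg (erase_subset _ _)
            fun _ _ _ => abs_nonneg _).trans hwx'
      _ ≤ 1 / b := by
          rw [hc, div_le_div_iff₀ (by linarith) (by linarith)]
          linarith
  have hmem : m ∈ range (2 * m + 1) := mem_range.2 (by omega)
  set A : ℝ := ∑ i ∈ range (2 * m + 1), w i with hA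
  set B : ℝ := ∑ i ∈ range (2 * m + 1), w i * x i with hB
  have hAb : |A - 1| ≤ 1 / b := by
    rw [hA, ← add_sum_erase _ _ hmem, hwm, add_sub_cancel_left]
    exact (abs_sum_le_sum_abs _ _).trans hws
  have hBb : |B| ≤ 1 / 2 := (abs_sum_le_sum_abs _ _).trans hwx'
  have hb2 : 1 / b ≤ 1 / 2 := one_div_le_one_div_of_le (by norm_num) hb
  obtain ⟨hA1, hA2⟩ := abs_le.1 hAb
  obtain ⟨hB1, hB2⟩ := abs_le.1 hBb
  -- The atoms `wb` at `b` and `-(A + wb)` at `1` are the solution of the two equations of zero mass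
  -- and zero mean. Their signs put `b` in the first prior and `1` in the second.
  set wb : ℝ := (A - B) / (b - 1) with hwb
  have hwb0 : 0 ≤ wb := div_nonneg (by linarith) (by linarith)
  have hwb1 : wb ≤ 4 / b := by
    rw [hwb, div_le_div_iff₀ (by linarith) (by linarith)]
    nlinarith
  have hwbe : wb * (b - 1) = A - B := div_mul_cancel₀ _ (by linarith)
  let V : Fin (2 * m + 1) ⊕ Bool → ℝ :=
    Sum.elim (fun i => x i) (fun t => if t then b else 1)
  let w' : Fin (2 * m + 1) ⊕ Bool → ℝ :=
    Sum.elim (fun i => w i) (fun t => if t then wb else -(A + wb))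
  have hsum : ∀ g : ℝ → ℝ → ℝ, ∑ j, g (w' j) (V j)
      = ∑ i ∈ range (2 * m + 1), g (w i) (x i) + (g wb b + g (-(A + wb)) 1) := fun g => by
    rw [Fintype.sum_sum_type, sum_range (fun i => g (w i) (x i))]
    simp [V, w']
  have hmom : ∀ k < m + 2, ∑ j, w' j * V j ^ k = 0 := by
    intro k
    induction k using Nat.strong_induction_on with
    | _ k ih =>
      intro hk
      match k, ih, hk with
      | 0, _, _ =>
        rw [hsum fun p q => p * q ^ 0]
        simp only [pow_zero, mul_one]
        rw [← hA]; ring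
      | 1, _, _ =>
        rw [hsum fun p q => p * q ^ 1]
        simp only [pow_one, mul_one]
        rw [← hB]; linarith
      | k + 2, ih, hk =>
        have h0 := ih k (by omega) (by omega)
        have h1 := ih (k + 1) (by omega) (by omega)
        -- The factor kills the two extra atoms and cancels the denominator, leaving a vanishing
        -- moment of `ν`; this gives a recursion for moment `k + 2` in terms of `k + 1` and `k`.
        have h2 : ∑ j, w' j * ((V j - 1) * (V j - b) * V j ^ k) = 0 := by
          rw [hsum fun p q => p * ((q - 1) * (q - b) * q ^ k)]
          simp only [sub_self, mul_zero, zero_mul, add_zero]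
          calc _ = ∑ i ∈ range (2 * m + 1), b * (ν i * x i ^ k) := by
                refine sum_congr rfl fun i _ => ?_
                calc w i * ((x i - 1) * (x i - b) * x i ^ k)
                    = ν i * b / ((x i - 1) * (x i - b)) * ((x i - 1) * (x i - b)) * x i ^ k := by
                      simp only [hw]; ring
                  _ = _ := by rw [div_mul_cancel₀ _ (hden i)]; ring
            _ = 0 := by rw [← mul_sum, hνx k (by omega), mul_zero]
        calc _ = ∑ j, (w' j * ((V j - 1) * (V j - b) * V j ^ k) + (1 + b) * (w' j * V j ^ (k + 1))
              - b * (w' j * V j ^ k)) := sum_congr rfl fun j _ => by ring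
          _ = 0 := by
            rw [sum_sub_distrib, sum_add_distrib, ← mul_sum, ← mul_sum, h0, h1, h2]; ring
  obtain ⟨W, hW1, ha1, ha1', hmm⟩ := exists_probability_split V w' (m + 2) (by omega) hmom
    (Sum.inl ⟨m, by omega⟩) (by simp [w', hwm])
  have hW0 : 0 < W := by linarith
  have hA0 : 0 ≤ A + wb := by linarith
  refine ⟨_, inferInstance, V, fun j => max (w' j) 0 / W, fun j => max (-w' j) 0 / W,
    fun j => div_nonneg (le_max_right _ _) hW0.le, fun j => div_nonneg (le_max_right _ _) hW0.le,
    ha1, ha1', ?_, ?_, hmm, ?_, ?_, ?_⟩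
  · rintro (i | t)
    · simp only [V, Sum.elim_inl, hx]; positivity
    · cases t <;> simp [V]; linarith
  · have hm2 : (1 : ℝ) ≤ (m : ℝ) ^ 2 := by
      have : (1 : ℝ) ≤ m := by exact_mod_cast hm
      nlinarith
    rintro (i | t)
    · simp only [V, Sum.elim_inl, hx]
      exact mul_le_mul_of_nonneg_left (hzle i (mem_range.2 i.2)) (by linarith)
    · cases t <;> simp [V] <;> nlinarith
  · rintro (i | t) h
    · by_cases hi : (i : ℕ) = m
      · exfalso; apply h
        simp [w', hi, hwm]
      · have := hxc i hi
        simp only [V, Sum.elim_inl]; linarith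
    · cases t <;> simp [V]; linarith
  · rw [hsum fun p q => max p 0 / W * (if q = 0 then 0 else 1)]
    have h1 : ∑ i ∈ range (2 * m + 1), max (w i) 0 / W * (if x i = 0 then 0 else 1) ≤ 1 / b := by
      rw [← add_sum_erase _ _ hmem, if_pos hxm, mul_zero, zero_add]
      refine (sum_le_sum fun i hi => ?_).trans hws
      have h2 : max (w i) 0 / W ≤ |w i| :=
        (div_le_self (le_max_right _ _) hW1).trans (max_le (le_abs_self _) (abs_nonneg _))
      refine le_trans (mul_le_of_le_one_right (div_nonneg (le_max_right _ _) hW0.le) ?_) h2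
      split_ifs <;> norm_num
    rw [max_eq_left hwb0, max_eq_right (by linarith), if_neg (by linarith), if_neg one_ne_zero]
    have h3 : wb / W ≤ 4 / b := (div_le_self hwb0 hW1).trans hwb1
    have h4 : (5 : ℝ) / b = 1 / b + 4 / b := by ring
    rw [h4, zero_div, zero_mul, add_zero, mul_one]
    exact add_le_add h1 h3
  · rw [hsum fun p q => max (-p) 0 / W * q]
    have h1 : ∑ i ∈ range (2 * m + 1), max (-w i) 0 / W * x i ≤ 1 / 2 := by
      refine (sum_le_sum fun i hi => ?_).trans hwx'
      have hx0 : 0 ≤ x i := by simp only [hx]; positivity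
      rw [abs_mul, abs_of_nonneg hx0]
      gcongr
      exact (div_le_self (le_max_right _ _) hW1).trans (max_le (neg_le_abs _) (abs_nonneg _))
    have h2 : max (- -(A + wb)) 0 / W ≤ 1 := by
      rw [← ha1']
      exact single_le_sum (f := fun j => max (-w' j) 0 / W)
        (fun j _ => div_nonneg (le_max_right _ _) hW0.le) (mem_univ (Sum.inr false))
    have h3 : max (-wb) 0 / W * b = 0 := by
      rw [max_eq_right (by linarith)]; simp
    linarith

/-! ### Finite product expectations and the hybrid argument -/

/-- The expectation of `Φ` over `n` independent draws from the weights `a`. -/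
noncomputable def prodExpect {J : Type} [Fintype J] {n : ℕ} (a : J → ℝ) (Φ : (Fin n → J) → ℝ) :
    ℝ :=
  ∑ σ : Fin n → J, (∏ i, a (σ i)) * Φ σ

section ProdExpect

variable {J : Type} [Fintype J] {n : ℕ}

theorem prodExpect_zero (a : J → ℝ) (Φ : (Fin 0 → J) → ℝ) : prodExpect a Φ = Φ Fin.elim0 := by
  simp only [prodExpect, Finset.univ_eq_empty, Finset.prod_empty, one_mul, Fintype.sum_unique]
  exact congrArg Φ (Subsingleton.elim _ _)

theorem prodExpect_succ (a : J → ℝ) (Φ : (Fin (n + 1) → J) → ℝ) :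
    prodExpect a Φ = ∑ j, a j * prodExpect a fun τ : Fin n → J => Φ (Fin.cons j τ) := by
  unfold prodExpect
  rw [← (Fin.consEquiv fun _ : Fin (n + 1) => J).sum_comp, Fintype.sum_prod_type]
  refine Finset.sum_congr rfl fun j _ => ?_
  rw [Finset.mul_sum]
  refine Finset.sum_congr rfl fun τ _ => ?_
  rw [← mul_assoc]
  congr 1
  rw [Fin.prod_univ_succ]
  simp [Fin.consEquiv]

theorem prodExpect_const {a : J → ℝ} (ha : ∑ j, a j = 1) (r : ℝ) :
    prodExpect a (fun _ : Fin n → J => r) = r := by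
  induction n with
  | zero => rw [prodExpect_zero]
  | succ n ih => rw [prodExpect_succ]; simp only [ih]; rw [← Finset.sum_mul, ha, one_mul]

theorem prodExpect_mono {a : J → ℝ} (ha : ∀ j, 0 ≤ a j) {Φ Ψ : (Fin n → J) → ℝ}
    (h : ∀ σ, (∀ i, a (σ i) ≠ 0) → Φ σ ≤ Ψ σ) : prodExpect a Φ ≤ prodExpect a Ψ := by
  refine Finset.sum_le_sum fun σ _ => ?_
  by_cases hσ : ∀ i, a (σ i) ≠ 0
  · exact mul_le_mul_of_nonneg_left (h σ hσ) (Finset.prod_nonneg fun i _ => ha _)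
  · push Not at hσ
    obtain ⟨i, hi⟩ := hσ
    rw [Finset.prod_eq_zero (Finset.mem_univ i) hi, zero_mul, zero_mul]

theorem prodExpect_sub (a : J → ℝ) (Φ Ψ : (Fin n → J) → ℝ) :
    prodExpect a (fun σ => Φ σ - Ψ σ) = prodExpect a Φ - prodExpect a Ψ := by
  simp only [prodExpect, mul_sub, Finset.sum_sub_distrib]

theorem prodExpect_const_mul (a : J → ℝ) (r : ℝ) (Φ : (Fin n → J) → ℝ) :
    prodExpect a (fun σ => r * Φ σ) = r * prodExpect a Φ := by
  simp only [prodExpect, Finset.mul_sum]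
  exact Finset.sum_congr rfl fun _ _ => by ring

theorem abs_prodExpect_le {a : J → ℝ} (ha : ∀ j, 0 ≤ a j) (ha1 : ∑ j, a j = 1)
    {Φ : (Fin n → J) → ℝ} {δ : ℝ} (h : ∀ σ, |Φ σ| ≤ δ) : |prodExpect a Φ| ≤ δ := by
  rw [abs_le]
  constructor
  · rw [← prodExpect_const (n := n) ha1 (-δ)]
    exact prodExpect_mono ha fun σ _ => (abs_le.1 (h σ)).1
  · rw [← prodExpect_const (n := n) ha1 δ]
    exact prodExpect_mono ha fun σ _ => (abs_le.1 (h σ)).2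

theorem prodExpect_sum_apply {a : J → ℝ} (ha : ∑ j, a j = 1) (g : J → ℝ) :
    prodExpect a (fun σ : Fin n → J => ∑ i, g (σ i)) = n * ∑ j, a j * g j := by
  induction n with
  | zero => rw [prodExpect_zero]; simp
  | succ n ih =>
    rw [prodExpect_succ]
    have h : ∀ j, prodExpect a (fun τ : Fin n → J => ∑ i, g ((Fin.cons j τ : Fin (n + 1) → J) i))
        = g j + n * ∑ j, a j * g j := fun j => by
      rw [← ih, ← prodExpect_const (n := n) ha (g j)]
      simp only [prodExpect, Fin.sum_univ_succ, Fin.cons_zero, Fin.cons_succ, mul_add,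
        Finset.sum_add_distrib]
    simp only [h, mul_add, Finset.sum_add_distrib]
    rw [← Finset.sum_mul, ha]
    push_cast
    ring

/-- Markov's inequality for a sum of independent nonnegative variables. -/
theorem one_sub_le_prodExpect_sum_lt {a : J → ℝ} (ha : ∀ j, 0 ≤ a j) (ha1 : ∑ j, a j = 1)
    {g : J → ℝ} (hg : ∀ j, 0 ≤ g j) {t : ℝ} (ht : 0 < t) :
    1 - n * (∑ j, a j * g j) / t ≤
      prodExpect a fun σ : Fin n → J => if ∑ i, g (σ i) < t then 1 else 0 := by
  rw [← prodExpect_sum_apply ha1, div_eq_inv_mul, ← prodExpect_const_mul]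
  nth_rewrite 1 [← prodExpect_const (n := n) ha1 1]
  rw [← prodExpect_sub]
  refine prodExpect_mono ha fun σ _ => ?_
  have h0 : 0 ≤ ∑ i, g (σ i) := Finset.sum_nonneg fun _ _ => hg _
  split_ifs with h
  · have : 0 ≤ t⁻¹ * ∑ i, g (σ i) := by positivity
    linarith
  · rw [← div_eq_inv_mul, sub_nonpos, one_le_div ht]
    exact not_lt.1 h

/-- The hybrid argument: if exchanging the weights `a` for `a'` in a single coordinate changes the
expectation by at most `δ`, then exchanging them in all coordinates changes it by at most `n δ`. -/
theorem abs_prodExpect_sub_prodExpect_le {a a' : J → ℝ} (ha : ∀ j, 0 ≤ a j)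
    (ha1 : ∑ j, a j = 1) (ha' : ∀ j, 0 ≤ a' j) (ha1' : ∑ j, a' j = 1)
    {Φ : (Fin n → J) → ℝ} {δ : ℝ}
    (h : ∀ i σ, |∑ j, (a j - a' j) * Φ (Function.update σ i j)| ≤ δ) :
    |prodExpect a Φ - prodExpect a' Φ| ≤ n * δ := by
  induction n with
  | zero => simp [prodExpect_zero]
  | succ n ih =>
    -- `h1` exchanges the later coordinates with the first one drawn from `a`; `h2` exchanges the
    -- first with the later ones drawn from `a'`.
    have h1 : |∑ j, a j * (prodExpect a (fun τ : Fin n → J => Φ (Fin.cons j τ))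
        - prodExpect a' fun τ : Fin n → J => Φ (Fin.cons j τ))| ≤ n * δ := by
      calc _ ≤ ∑ j, a j * (n * δ) := by
            refine (Finset.abs_sum_le_sum_abs _ _).trans (Finset.sum_le_sum fun j _ => ?_)
            rw [abs_mul, abs_of_nonneg (ha j)]
            refine mul_le_mul_of_nonneg_left (ih fun i σ => ?_) (ha j)
            simp only [Fin.cons_update]
            exact h i.succ (Fin.cons j σ)
        _ = n * δ := by rw [← Finset.sum_mul, ha1, one_mul]
    have h2 : |prodExpect a' fun τ : Fin n → J => ∑ j, (a j - a' j) * Φ (Fin.cons j τ)| ≤ δ := by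
      refine abs_prodExpect_le ha' ha1' fun τ => ?_
      by_cases hJ : Nonempty J
      · obtain ⟨j₀⟩ := hJ
        simpa only [Fin.update_cons_zero] using h 0 (Fin.cons j₀ τ)
      · rw [not_nonempty_iff] at hJ
        simp at ha1
    have h3 : (∑ j, (a j - a' j) * prodExpect a' fun τ : Fin n → J => Φ (Fin.cons j τ))
        = prodExpect a' fun τ : Fin n → J => ∑ j, (a j - a' j) * Φ (Fin.cons j τ) := by
      simp only [prodExpect, Finset.mul_sum]
      rw [Finset.sum_comm]
      exact Finset.sum_congr rfl fun _ _ => Finset.sum_congr rfl fun _ _ => by ring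
    rw [← h3] at h2
    have h4 : prodExpect a Φ - prodExpect a' Φ
        = ∑ j, a j * (prodExpect a (fun τ : Fin n → J => Φ (Fin.cons j τ))
        - prodExpect a' fun τ : Fin n → J => Φ (Fin.cons j τ))
        + ∑ j, (a j - a' j) * prodExpect a' fun τ : Fin n → J => Φ (Fin.cons j τ) := by
      rw [prodExpect_succ, prodExpect_succ, ← Finset.sum_add_distrib, ← Finset.sum_sub_distrib]
      exact Finset.sum_congr rfl fun _ _ => by ring
    rw [h4]
    refine (abs_add_le _ _).trans ?_
    push_cast
    linarith

end ProdExpect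

/-! ### Indistinguishability from matched moments -/

open Finset in
/-- A test of `q` samples from the mixture `(1 - x) A + x B` has nearly the same expectation under
two priors on `x` whose moments below `L` agree. -/
theorem abs_sum_mul_sum_prod_mixture_le {Ω J : Type} [Fintype Ω] [Fintype J] {q : ℕ}
    {A B : Ω → ℝ} (hA : ∀ ω, 0 ≤ A ω) (hA1 : ∑ ω, A ω = 1) (hB : ∀ ω, 0 ≤ B ω)
    (hB1 : ∑ ω, B ω = 1) {φ : (Fin q → Ω) → ℝ} (hφ : ∀ s, |φ s| ≤ 1)
    {w x : J → ℝ} {y : ℝ} (hw : ∑ j, |w j| ≤ 2) (hx : ∀ j, |x j| ≤ y) {L : ℕ}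
    (hm : ∀ k < L, ∑ j, w j * x j ^ k = 0) {R : ℝ} (hR : 1 ≤ R) (hy : 0 ≤ y) :
    |∑ j, w j * ∑ s : Fin q → Ω, φ s * ∏ t, ((1 - x j) * A (s t) + x j * B (s t))|
      ≤ 2 * (R⁻¹) ^ L * (1 + 2 * y * R) ^ q := by
  classical
  -- Writing the mixture as `A + x * (B - A)` and expanding over the set `T` of draws using `B - A`
  -- gives a polynomial in `x`, with `K T` as coefficients.
  set K : Finset (Fin q) → ℝ := fun T => ∑ s : Fin q → Ω,
    φ s * ((∏ t ∈ T, (B (s t) - A (s t))) * ∏ t ∈ univ \ T, A (s t)) with hK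
  have hexp : ∀ j, ∑ s : Fin q → Ω, φ s * ∏ t, ((1 - x j) * A (s t) + x j * B (s t))
      = ∑ T ∈ (univ : Finset (Fin q)).powerset, x j ^ #T * K T := fun j => by
    simp only [hK, mul_sum]
    rw [sum_comm]
    refine sum_congr rfl fun s _ => ?_
    have : ∀ t, (1 - x j) * A (s t) + x j * B (s t) = x j * (B (s t) - A (s t)) + A (s t) :=
      fun t => by ring
    simp only [this]
    rw [prod_add, mul_sum]
    refine sum_congr rfl fun T _ => ?_
    rw [prod_mul_distrib, prod_const]
    ring
  have hKle : ∀ T, |K T| ≤ 2 ^ #T := fun T => by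
    have hd : ∑ ω, |B ω - A ω| ≤ 2 := by
      calc _ ≤ ∑ ω, (B ω + A ω) := sum_le_sum fun ω _ => by
            rw [abs_le]; constructor <;> linarith [hA ω, hB ω]
        _ = 2 := by rw [sum_add_distrib, hA1, hB1]; norm_num
    calc |K T| ≤ ∑ s : Fin q → Ω, ∏ t, (if t ∈ T then |B (s t) - A (s t)| else A (s t)) := by
          refine (abs_sum_le_sum_abs _ _).trans (sum_le_sum fun s _ => ?_)
          rw [abs_mul]
          refine (mul_le_of_le_one_left (abs_nonneg _) (hφ s)).trans (le_of_eq ?_)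
          rw [prod_ite, abs_mul, abs_prod, abs_prod]
          congr 1
          · exact prod_congr (by ext; simp) fun _ _ => rfl
          · exact prod_congr (by ext; simp) fun _ _ => abs_of_nonneg (hA _)
      _ = ∏ t, ∑ ω, (if t ∈ T then |B ω - A ω| else A ω) := by
          rw [prod_univ_sum, Fintype.piFinset_univ]
      _ ≤ ∏ t : Fin q, (if t ∈ T then 2 else 1) := by
          refine prod_le_prod (fun t _ => sum_nonneg fun ω _ => ?_) fun t _ => ?_
          · split_ifs
            exacts [abs_nonneg _, hA ω]
          · split_ifs
            exacts [hd, hA1.le]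
      _ = 2 ^ #T := by rw [prod_ite_mem, univ_inter, prod_const]
  -- For `k ≥ L` the factor `R ^ (k - L) ≥ 1` is inserted, so one bound serves all `k` and the sum
  -- over `T` is binomial.
  have hmom : ∀ k, |∑ j, w j * x j ^ k| ≤ 2 * (R⁻¹) ^ L * (y * R) ^ k := fun k => by
    have hR0 : 0 < R := by linarith
    rcases lt_or_ge k L with hk | hk
    · rw [hm k hk, abs_zero]; positivity
    · calc _ ≤ ∑ j, |w j| * y ^ k := by
            refine (abs_sum_le_sum_abs _ _).trans (sum_le_sum fun j _ => ?_)
            rw [abs_mul, abs_pow]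
            gcongr
            exact hx j
        _ ≤ 2 * y ^ k := by rw [← sum_mul]; gcongr
        _ ≤ 2 * y ^ k * ((R⁻¹) ^ L * R ^ k) := by
            refine le_mul_of_one_le_right (by positivity) ?_
            rw [inv_pow, inv_mul_eq_div, one_le_div (by positivity)]
            exact pow_le_pow_right₀ hR hk
        _ = 2 * (R⁻¹) ^ L * (y * R) ^ k := by rw [mul_pow]; ring
  calc |∑ j, w j * ∑ s : Fin q → Ω, φ s * ∏ t, ((1 - x j) * A (s t) + x j * B (s t))|
      = |∑ T ∈ (univ : Finset (Fin q)).powerset, (∑ j, w j * x j ^ #T) * K T| := by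
        congr 1
        simp only [hexp, mul_sum, sum_mul]
        rw [sum_comm]
        exact sum_congr rfl fun _ _ => sum_congr rfl fun _ _ => by ring
    _ ≤ ∑ T ∈ (univ : Finset (Fin q)).powerset, 2 * (R⁻¹) ^ L * (2 * y * R) ^ #T := by
        refine (abs_sum_le_sum_abs _ _).trans (sum_le_sum fun T _ => ?_)
        rw [abs_mul]
        calc _ ≤ 2 * (R⁻¹) ^ L * (y * R) ^ #T * 2 ^ #T := by
              gcongr
              exacts [hmom _, hKle T]
          _ = _ := by rw [mul_assoc, ← mul_pow]; congr 2; ring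
    _ = 2 * (R⁻¹) ^ L * (1 + 2 * y * R) ^ q := by
        rw [← mul_sum]
        congr 1
        have := sum_pow_mul_eq_add_pow (2 * y * R) 1 (univ : Finset (Fin q))
        simp only [one_pow, mul_one, card_univ, Fintype.card_fin] at this
        rw [this, add_comm]

/-! ### First-success laws -/

/-- The law of the first success in a sequence of independent trials with success probabilities
`p`, where `none` stands for no success at all. -/
noncomputable def firstSuccess {n : ℕ} (p : Fin n → ℝ) : Option (Fin n) → ℝ
  | none => ∏ j, (1 - p j)
  | some i => ∏ j, if j < i then 1 - p j else if j = i then p j else 1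

section FirstSuccess

variable {n : ℕ} {p : Fin n → ℝ}

theorem firstSuccess_some (p : Fin n → ℝ) (i : Fin n) :
    firstSuccess p (some i) = p i * ∏ j with j < i, (1 - p j) := by
  simp only [firstSuccess]
  rw [← Finset.mul_prod_erase _ _ (Finset.mem_univ i), if_neg (lt_irrefl i), if_pos rfl,
    Finset.prod_filter]
  congr 1
  rw [← Finset.mul_prod_erase Finset.univ (fun j => if j < i then 1 - p j else 1)
    (Finset.mem_univ i), if_neg (lt_irrefl i), one_mul]
  refine Finset.prod_congr rfl fun j hj => ?_
  rw [if_neg (Finset.ne_of_mem_erase hj)]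

theorem sum_firstSuccess (p : Fin n → ℝ) : ∑ ω, firstSuccess p ω = 1 := by
  rw [Fintype.sum_option]
  simp only [firstSuccess_some]
  simp only [firstSuccess]
  rw [Finset.prod_one_sub_ordered]
  ring

theorem firstSuccess_nonneg (h0 : ∀ i, 0 ≤ p i) (h1 : ∀ i, p i ≤ 1) (ω : Option (Fin n)) :
    0 ≤ firstSuccess p ω := by
  cases ω with
  | none => exact Finset.prod_nonneg fun j _ => sub_nonneg.2 (h1 j)
  | some i =>
    rw [firstSuccess_some]
    exact mul_nonneg (h0 i) (Finset.prod_nonneg fun j _ => sub_nonneg.2 (h1 j))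

/-- Union bound: no earlier trial succeeds with probability at least `1 - ∑ j, p j`. -/
theorem mul_one_sub_sum_le_firstSuccess (h0 : ∀ i, 0 ≤ p i) (h1 : ∀ i, p i ≤ 1) (i : Fin n) :
    p i * (1 - ∑ j, p j) ≤ firstSuccess p (some i) := by
  have hle : ∀ s : Finset (Fin n), ∏ j ∈ s, (1 - p j) ≤ 1 := fun s =>
    Finset.prod_le_one (fun j _ => sub_nonneg.2 (h1 j)) fun j _ => by linarith [h0 j]
  rw [firstSuccess_some]
  refine mul_le_mul_of_nonneg_left ?_ (h0 i)
  calc 1 - ∑ j, p j ≤ ∏ j, (1 - p j) := by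
        rw [Finset.prod_one_sub_ordered]
        gcongr with j
        exact mul_le_of_le_one_right (h0 j) (hle _)
    _ = (∏ j with j < i, (1 - p j)) * ∏ j with ¬ j < i, (1 - p j) :=
        (Finset.prod_filter_mul_prod_filter_not _ _ _).symm
    _ ≤ ∏ j with j < i, (1 - p j) :=
        mul_le_of_le_one_right (Finset.prod_nonneg fun j _ => sub_nonneg.2 (h1 j)) (hle _)

/-- Each success probability enters at most one factor, so the law is affine in it. This is why
first-success laws replace normalised weights: they have total mass `1` for any `p`, and changing
one coordinate stays within a mixture of two fixed laws. -/
theorem firstSuccess_update (p : Fin n → ℝ) (i : Fin n) (x : ℝ) (ω : Option (Fin n)) :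
    firstSuccess (Function.update p i x) ω =
      (1 - x) * firstSuccess (Function.update p i 0) ω +
        x * firstSuccess (Function.update p i 1) ω := by
  cases ω with
  | none =>
    simp only [firstSuccess]
    rw [← Finset.mul_prod_erase _ _ (Finset.mem_univ i),
      ← Finset.mul_prod_erase _ (fun j => 1 - Function.update p i 0 j) (Finset.mem_univ i),
      ← Finset.mul_prod_erase _ (fun j => 1 - Function.update p i 1 j) (Finset.mem_univ i)]
    have h : ∀ y, ∏ j ∈ Finset.univ.erase i, (1 - Function.update p i y j)
        = ∏ j ∈ Finset.univ.erase i, (1 - p j) := fun y =>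
      Finset.prod_congr rfl fun j hj => by rw [Function.update_of_ne (Finset.ne_of_mem_erase hj)]
    simp only [h, Function.update_self]
    ring
  | some k =>
    simp only [firstSuccess]
    set F : ℝ → Fin n → ℝ := fun y j => if j < k then 1 - Function.update p i y j else
      if j = k then Function.update p i y j else 1 with hF
    have h : ∀ y, ∏ j, F y j = F y i * ∏ j ∈ Finset.univ.erase i, F 0 j := fun y => by
      rw [← Finset.mul_prod_erase _ _ (Finset.mem_univ i)]
      congr 1
      refine Finset.prod_congr rfl fun j hj => ?_
      simp only [hF, Function.update_of_ne (Finset.ne_of_mem_erase hj)]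
    have e : ∀ y, F y i = if i < k then 1 - y else if i = k then y else 1 := fun y => by
      simp only [hF, Function.update_self]
    change ∏ j, F x j = (1 - x) * ∏ j, F 0 j + x * ∏ j, F 1 j
    rw [h x, h 0, h 1, e x, e 0, e 1]
    split_ifs <;> ring

end FirstSuccess

/-- A test of `q` samples from a first-success law with independent random success probabilities
has nearly the same expectation under two priors whose moments below `L` agree. -/
theorem abs_prodExpect_firstSuccess_sub_le {J : Type} [Fintype J] {n q : ℕ} {a a' v : J → ℝ}
    (ha : ∀ j, 0 ≤ a j) (ha1 : ∑ j, a j = 1) (ha' : ∀ j, 0 ≤ a' j) (ha1' : ∑ j, a' j = 1)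
    {y : ℝ} (hv0 : ∀ j, 0 ≤ v j) (hvy : ∀ j, v j ≤ y) (hy0 : 0 ≤ y) (hy1 : y ≤ 1) {L : ℕ}
    (hm : ∀ k < L, ∑ j, a j * v j ^ k = ∑ j, a' j * v j ^ k)
    {φ : (Fin q → Option (Fin n)) → ℝ} (hφ : ∀ s, |φ s| ≤ 1) {R : ℝ} (hR : 1 ≤ R) :
    |prodExpect a (fun σ => ∑ s, φ s * ∏ t, firstSuccess (fun i => v (σ i)) (s t)) -
        prodExpect a' (fun σ => ∑ s, φ s * ∏ t, firstSuccess (fun i => v (σ i)) (s t))|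
      ≤ n * (2 * (R⁻¹) ^ L * (1 + 2 * y * R) ^ q) := by
  refine abs_prodExpect_sub_prodExpect_le ha ha1 ha' ha1' fun i σ => ?_
  set p : Fin n → ℝ := fun i => v (σ i) with hp
  have hu : ∀ j, (fun k => v (Function.update σ i j k)) = Function.update p i (v j) := fun j => by
    ext k
    by_cases hk : k = i
    · subst hk; simp
    · simp [Function.update_of_ne hk, hp]
  have hb : ∀ z : ℝ, 0 ≤ z → z ≤ 1 → ∀ ω, 0 ≤ firstSuccess (Function.update p i z) ω := by
    intro z hz0 hz1 ω
    refine firstSuccess_nonneg (fun k => ?_) (fun k => ?_) ω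
    · by_cases hk : k = i
      · subst hk; simpa using hz0
      · rw [Function.update_of_ne hk]; exact hv0 _
    · by_cases hk : k = i
      · subst hk; simpa using hz1
      · rw [Function.update_of_ne hk]; exact (hvy _).trans hy1
  simp only [hu]
  have e : ∀ j ω, firstSuccess (Function.update p i (v j)) ω
      = (1 - v j) * firstSuccess (Function.update p i 0) ω
        + v j * firstSuccess (Function.update p i 1) ω := fun j ω => firstSuccess_update p i _ ω
  simp only [e]
  refine abs_sum_mul_sum_prod_mixture_le (hb 0 le_rfl zero_le_one) (sum_firstSuccess _)
    (hb 1 zero_le_one le_rfl) (sum_firstSuccess _) hφ ?_ (fun j => ?_) (fun k hk => ?_) hR hy0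
  · calc _ ≤ ∑ j, (a j + a' j) := Finset.sum_le_sum fun j _ => by
          rw [abs_le]; constructor <;> linarith [ha j, ha' j]
      _ ≤ 2 := by rw [Finset.sum_add_distrib, ha1, ha1']; norm_num
  · rw [abs_of_nonneg (hv0 j)]; exact hvy j
  · simp only [sub_mul, Finset.sum_sub_distrib, hm k hk, sub_self]

/-! ### A labelling far from the class -/

-- Weight each set `E` by `x ^ #E`: the total is `(1 + x) ^ n` with `n` the number of points, and
-- each counted set weighs at least `x ^ r`.
open Finset in
theorem card_filter_card_le_mul_pow_le {α : Type*} [Fintype α] [DecidableEq α] (r : ℕ) {x : ℝ}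
    (hx0 : 0 ≤ x) (hx1 : x ≤ 1) :
    (#{E : Finset α | #E ≤ r} : ℝ) * x ^ r ≤ (1 + x) ^ Fintype.card α := by
  have h := sum_pow_mul_eq_add_pow x 1 (univ : Finset α)
  simp only [one_pow, mul_one, card_univ, powerset_univ] at h
  rw [add_comm, ← h, ← nsmul_eq_mul, ← sum_const]
  refine (sum_le_sum fun E hE => ?_).trans
    (sum_le_sum_of_subset_of_nonneg (subset_univ _) fun _ _ _ => by positivity)
  exact pow_le_pow_of_le_one hx0 hx1 (mem_filter.1 hE).2

open Finset symmDiff in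
/-- A class whose traces on `5 d` points shatter only sets of size at most `d` is far, in Hamming
distance on these points, from some labelling. -/
theorem exists_labelling_far {X : Type u} (H : Set (X → Bool)) {d : ℕ} (hd : 1 ≤ d)
    (x : Fin (5 * d) → X)
    (hH : ∀ s : Finset (Fin (5 * d)),
      (∀ l : Fin (5 * d) → Bool, ∃ h ∈ H, ∀ i ∈ s, h (x i) = l i) → #s ≤ d) :
    ∃ l : Fin (5 * d) → Bool, ∀ h ∈ H, d < 200 * #{i | l i ≠ h (x i)} := by
  classical
  set 𝒜 : Finset (Finset (Fin (5 * d))) := {A | ∃ h ∈ H, ∀ i, i ∈ A ↔ h (x i) = true} with h𝒜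
  have hA : #𝒜 ≤ #{E : Finset (Fin (5 * d)) | #E ≤ d} := by
    refine (card_le_card_shatterer 𝒜).trans (card_le_card fun s hs => ?_)
    refine mem_filter.2 ⟨mem_univ _, hH s fun l => ?_⟩
    obtain ⟨u, hu, hsu⟩ := (mem_shatterer.1 hs) (filter_subset (fun i => l i = true) s)
    obtain ⟨h, hh, hhu⟩ := (mem_filter.1 hu).2
    refine ⟨h, hh, fun i hi => ?_⟩
    have h1 := hhu i
    have h2 : i ∈ s ∩ u ↔ i ∈ s.filter fun i => l i = true := by rw [hsu]
    simp only [mem_inter, mem_filter, hi, true_and] at h2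
    rw [h1] at h2
    exact Bool.eq_iff_iff.2 h2
  set r := d / 200 with hr
  -- The Hamming balls of radius `d / 200` around the traces cannot cover the cube: per unit of `d`
  -- their total volume grows by a factor below `16`, against `2 ^ 5`. The weight `1 / 4` is optimal
  -- for `d` out of `5 * d` points.
  have hcard : #𝒜 * #{E : Finset (Fin (5 * d)) | #E ≤ r} < 2 ^ (5 * d) := by
    have h1 := card_filter_card_le_mul_pow_le (α := Fin (5 * d)) d (x := 1 / 4) (by norm_num)
      (by norm_num)
    have h2 := card_filter_card_le_mul_pow_le (α := Fin (5 * d)) r (x := 1 / 20) (by norm_num)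
      (by norm_num)
    rw [Fintype.card_fin] at h1 h2
    have h3 : (20 : ℝ) ^ r ≤ (51 / 50) ^ d := by
      calc (20 : ℝ) ^ r ≤ ((51 / 50) ^ 200) ^ r := by gcongr; norm_num
        _ = (51 / 50) ^ (200 * r) := (pow_mul _ _ _).symm
        _ ≤ (51 / 50) ^ d := pow_le_pow_right₀ (by norm_num) (Nat.mul_div_le d 200)
    have h1' : (#𝒜 : ℝ) ≤ (1 + 1 / 4) ^ (5 * d) * 4 ^ d := by
      have : (#𝒜 : ℝ) * (1 / 4) ^ d ≤ (1 + 1 / 4) ^ (5 * d) :=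
        (mul_le_mul_of_nonneg_right (by exact_mod_cast hA) (by positivity)).trans h1
      rwa [one_div, inv_pow, ← div_eq_mul_inv, div_le_iff₀ (by positivity), ← one_div] at this
    have h2' : (#{E : Finset (Fin (5 * d)) | #E ≤ r} : ℝ) ≤ (1 + 1 / 20) ^ (5 * d) * 20 ^ r := by
      rwa [one_div, inv_pow, ← div_eq_mul_inv, div_le_iff₀ (by positivity), ← one_div] at h2
    have h4 : (#𝒜 : ℝ) * #{E : Finset (Fin (5 * d)) | #E ≤ r} < 2 ^ (5 * d) := by
      calc (#𝒜 : ℝ) * #{E : Finset (Fin (5 * d)) | #E ≤ r}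
          ≤ ((1 + 1 / 4) ^ (5 * d) * 4 ^ d) * ((1 + 1 / 20) ^ (5 * d) * (51 / 50) ^ d) := by
            gcongr
            exact h2'.trans (by gcongr)
        _ = ((1 + 1 / 4) ^ 5 * 4 * (1 + 1 / 20) ^ 5 * (51 / 50)) ^ d := by
            rw [pow_mul, pow_mul]
            simp only [mul_pow]
            ring
        _ < (2 ^ 5) ^ d := pow_lt_pow_left₀ (by norm_num) (by norm_num) (by omega)
        _ = 2 ^ (5 * d) := (pow_mul _ _ _).symm
    exact_mod_cast h4
  set bad : Finset (Finset (Fin (5 * d))) :=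
    𝒜.biUnion fun A => ({E | #E ≤ r} : Finset (Finset (Fin (5 * d)))).image fun E => A ∆ E with hbad
  have hbc : #bad < #(univ : Finset (Finset (Fin (5 * d)))) := by
    rw [card_univ, Fintype.card_finset, Fintype.card_fin]
    exact (card_biUnion_le_card_mul _ _ _ fun A _ => card_image_le).trans_lt hcard
  obtain ⟨B, -, hB⟩ := exists_mem_notMem_of_card_lt_card hbc
  refine ⟨fun i => decide (i ∈ B), fun h hh => ?_⟩
  by_contra hle
  push Not at hle
  apply hB
  set A : Finset (Fin (5 * d)) := {i | h (x i) = true} with hAdef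
  refine mem_biUnion.2 ⟨A, mem_filter.2 ⟨mem_univ _, h, hh, fun i => by simp [hAdef]⟩, ?_⟩
  refine mem_image.2 ⟨A ∆ B, mem_filter.2 ⟨mem_univ _, ?_⟩, symmDiff_symmDiff_cancel_left _ _⟩
  have : A ∆ B = ({i | decide (i ∈ B) ≠ h (x i)} : Finset (Fin (5 * d))) := by
    ext i
    simp only [mem_symmDiff, hAdef, mem_filter, mem_univ, true_and]
    cases h (x i) <;> by_cases hi : i ∈ B <;> simp [hi]
  rw [this, hr, Nat.le_div_iff_mul_le (by norm_num)]
  omega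

/-! ### Testers on finitely supported laws -/

/-- The law of the point `x ω` when `ω` is drawn with the probabilities `P`. -/
noncomputable def discreteLaw {X : Type u} [MeasurableSpace X] {Ω : Type} [Fintype Ω] (P : Ω → ℝ)
    (x : Ω → X) : Measure X :=
  ∑ ω, ENNReal.ofReal (P ω) • Measure.dirac (x ω)

section DiscreteLaw

variable {X : Type u} [MeasurableSpace X] [MeasurableSingletonClass X] {Ω : Type} [Fintype Ω]
  {P : Ω → ℝ} {x : Ω → X}

-- Since singletons are measurable, this holds for every set; disagreement sets need not be
-- measurable, because members of `H` need not be.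
open Classical in
theorem discreteLaw_apply (hP : ∀ ω, 0 ≤ P ω) (t : Set X) :
    discreteLaw P x t = ENNReal.ofReal (∑ ω with x ω ∈ t, P ω) := by
  rw [ENNReal.ofReal_sum_of_nonneg fun ω _ => hP ω, Finset.sum_filter]
  simp only [discreteLaw, Measure.coe_finsetSum, Finset.sum_apply, Measure.smul_apply,
    Measure.dirac_apply, smul_eq_mul, Set.indicator_apply, Pi.one_apply, mul_ite, mul_one, mul_zero]

theorem isProbabilityMeasure_discreteLaw (hP : ∀ ω, 0 ≤ P ω) (hP1 : ∑ ω, P ω = 1) :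
    IsProbabilityMeasure (discreteLaw P x) :=
  ⟨by rw [discreteLaw_apply hP]; simp [hP1]⟩

theorem discreteLaw_singleton (hP : ∀ ω, 0 ≤ P ω) (hx : Function.Injective x) (ω : Ω) :
    discreteLaw P x {x ω} = ENNReal.ofReal (P ω) := by
  classical
  rw [discreteLaw_apply hP]
  simp only [Set.mem_singleton_iff, hx.eq_iff]
  rw [Finset.sum_filter, Finset.sum_ite_eq' Finset.univ ω P, if_pos (Finset.mem_univ ω)]

theorem distToClass_discreteLaw_eq_zero (hP : ∀ ω, 0 ≤ P ω) {f : X → Bool} {H : Set (X → Bool)}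
    {h : X → Bool} (hh : h ∈ H) (hf : ∀ ω, P ω ≠ 0 → h (x ω) = f (x ω)) :
    distToClass (discreteLaw P x) f H = 0 := by
  classical
  refine le_antisymm ((iInf₂_le h hh).trans ?_) zero_le
  rw [discreteLaw_apply hP, Finset.sum_eq_zero, ENNReal.ofReal_zero]
  intro ω hω
  by_contra h0
  simp only [Finset.mem_filter, Finset.mem_univ, true_and] at hω
  exact hω (hf ω h0).symm

theorem le_distToClass_discreteLaw (hP : ∀ ω, 0 ≤ P ω) {f : X → Bool} {H : Set (X → Bool)} {ε : ℝ}
    (hf : ∀ h ∈ H, ε ≤ ∑ ω with f (x ω) ≠ h (x ω), P ω) :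
    ENNReal.ofReal ε ≤ distToClass (discreteLaw P x) f H := by
  classical
  refine le_iInf₂ fun h hh => ?_
  rw [discreteLaw_apply hP]
  refine ENNReal.ofReal_le_ofReal ((hf h hh).trans (le_of_eq ?_))
  exact Finset.sum_congr (by ext; simp) fun _ _ => rfl

/-- The probability of an event for `q` independent draws is the sum over the outcomes of the
draws. -/
theorem prod_pi_discreteLaw_apply {Y : Type v} [MeasurableSpace Y] (μ : Measure Y)
    [IsProbabilityMeasure μ] {q : ℕ} (hP : ∀ ω, 0 ≤ P ω) (hP1 : ∑ ω, P ω = 1)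
    (hx : Function.Injective x) {E : Set (Y × (Fin q → X))}
    (hE : NullMeasurableSet E (μ.prod (Measure.pi fun _ : Fin q => discreteLaw P x))) :
    μ.prod (Measure.pi fun _ : Fin q => discreteLaw P x) E =
      ENNReal.ofReal (∑ s : Fin q → Ω, (μ {z | (z, fun t => x (s t)) ∈ E}).toReal
        * ∏ t, P (s t)) := by
  classical
  have := isProbabilityMeasure_discreteLaw (x := x) hP hP1
  set D := discreteLaw P x
  set ν := Measure.pi fun _ : Fin q => D
  set F : (Fin q → Ω) → Set (Y × (Fin q → X)) := fun s => Set.univ ×ˢ {fun t => x (s t)} with hF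
  have hFm : ∀ s, MeasurableSet (F s) := fun s =>
    MeasurableSet.univ.prod (measurableSet_singleton _)
  have hνs : ∀ s : Fin q → Ω, ν {fun t => x (s t)} = ENNReal.ofReal (∏ t, P (s t)) := fun s => by
    rw [Measure.pi_singleton, ENNReal.ofReal_prod_of_nonneg fun t _ => hP _]
    exact Finset.prod_congr rfl fun t _ => discreteLaw_singleton hP hx _
  have hdisj : Pairwise (Function.onFun Disjoint F) := fun s s' hss => by
    refine Set.disjoint_left.2 fun z hz hz' => hss ?_
    have h1 : z.2 = fun t => x (s t) := hz.2
    have h2 : z.2 = fun t => x (s' t) := hz'.2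
    funext t
    exact hx (congrFun (h1.symm.trans h2) t)
  have hone : μ.prod ν (⋃ s ∈ (Finset.univ : Finset (Fin q → Ω)), F s) = 1 := by
    rw [measure_biUnion_finset (fun s _ s' _ h => hdisj h) fun s _ => hFm s]
    simp only [hF, Measure.prod_prod, measure_univ, one_mul, hνs]
    rw [← ENNReal.ofReal_sum_of_nonneg fun s _ => Finset.prod_nonneg fun t _ => hP _,
      ← Fintype.piFinset_univ, ← Finset.prod_univ_sum]
    simp [hP1]
  have hcompl : μ.prod ν (⋃ s ∈ (Finset.univ : Finset (Fin q → Ω)), F s)ᶜ = 0 :=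
    (prob_compl_eq_zero_iff (Finset.measurableSet_biUnion _ fun s _ => hFm s)).2 hone
  -- Almost all mass lies on the finitely many slices `F s`, on each of which `E` is a rectangle;
  -- null measurability of `E` is then enough.
  have hEe : μ.prod ν E = μ.prod ν (⋃ s ∈ (Finset.univ : Finset (Fin q → Ω)), E ∩ F s) := by
    rw [← Set.inter_iUnion₂, measure_inter_conull' ]
    exact measure_mono_null (fun z hz => hz.2) hcompl
  rw [hEe, measure_biUnion_finset₀ (fun s _ s' _ h => ((hdisj h).mono Set.inter_subset_right
    Set.inter_subset_right).aedisjoint) fun s _ => hE.inter (hFm s).nullMeasurableSet,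
    ENNReal.ofReal_sum_of_nonneg fun s _ =>
      mul_nonneg ENNReal.toReal_nonneg (Finset.prod_nonneg fun t _ => hP _)]
  refine Finset.sum_congr rfl fun s _ => ?_
  have hs : E ∩ F s = {z | (z, fun t => x (s t)) ∈ E} ×ˢ {fun t => x (s t)} := by
    ext ⟨z, y⟩
    simp only [hF, Set.mem_inter_iff, Set.mem_prod, Set.mem_univ, true_and, Set.mem_singleton_iff,
      Set.mem_ofPred_eq]
    constructor
    · rintro ⟨h1, rfl⟩; exact ⟨h1, rfl⟩
    · rintro ⟨h1, rfl⟩; exact ⟨h1, rfl⟩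
  rw [hs, Measure.prod_prod, hνs, ENNReal.ofReal_mul ENNReal.toReal_nonneg,
    ENNReal.ofReal_toReal (measure_ne_top _ _)]

/-- On the discrete laws on finitely many given points, and for a fixed function, a tester is a test
of the sampled points alone: its queries have known answers. -/
theorem RandomizedAlgorithm.IsTolerantTester.exists_sample_test {q : ℕ}
    {A : RandomizedAlgorithm.{u, v} X q} {H : Set (X → Bool)} {ε₀ ε₁ : ℝ}
    (hA : A.IsTolerantTester H ε₀ ε₁) (hx : Function.Injective x) {f : X → Bool}
    (hf : Measurable f) :
    ∃ φ : (Fin q → Ω) → ℝ, (∀ s, 0 ≤ φ s) ∧ (∀ s, φ s ≤ 1) ∧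
      ∀ P : Ω → ℝ, (∀ ω, 0 ≤ P ω) → ∑ ω, P ω = 1 →
        (distToClass (discreteLaw P x) f H ≤ ENNReal.ofReal ε₀ →
          2 / 3 ≤ ∑ s, φ s * ∏ t, P (s t)) ∧
        (ENNReal.ofReal ε₁ ≤ distToClass (discreteLaw P x) f H →
          ∑ s, φ s * ∏ t, P (s t) ≤ 1 / 3) := by
  -- `φ s` is the acceptance probability over the seed when the samples are `s`; with `f` fixed it
  -- does not depend on `P`.
  refine ⟨fun s => (A.law {z | (z, fun t => x (s t)) ∈ A.outputEvent f true}).toReal,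
    fun s => ENNReal.toReal_nonneg, fun s => measureReal_le_one, fun P hP hP1 => ?_⟩
  have hD := isProbabilityMeasure_discreteLaw (x := x) hP hP1
  obtain ⟨hm, h0, h1⟩ := hA (discreteLaw P x) hD f hf
  have e := prod_pi_discreteLaw_apply A.law hP hP1 hx (hm true)
  rw [← RandomizedAlgorithm.jointLaw] at e
  set r := ∑ s : Fin q → Ω, (A.law {z | (z, fun t => x (s t)) ∈ A.outputEvent f true}).toReal
    * ∏ t, P (s t) with hr
  have hr0 : 0 ≤ r := Finset.sum_nonneg fun s _ =>
    mul_nonneg ENNReal.toReal_nonneg (Finset.prod_nonneg fun t _ => hP _)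
  have h23 : (2 / 3 : ℝ≥0∞) = ENNReal.ofReal (2 / 3) := by
    rw [ENNReal.ofReal_div_of_pos (by norm_num)]; norm_num
  refine ⟨fun h => ?_, fun h => ?_⟩
  · have := h0 h
    rwa [e, h23, ENNReal.ofReal_le_ofReal_iff hr0] at this
  · have h2 := h1 h
    have hc : A.outputEvent f false = (A.outputEvent f true)ᶜ := by
      ext z; simp [RandomizedAlgorithm.outputEvent]
    have : IsProbabilityMeasure (A.jointLaw (discreteLaw P x)) := by
      unfold RandomizedAlgorithm.jointLaw; infer_instance
    have h3 := measure_add_measure_compl₀ (hm true)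
    rw [← hc, measure_univ, e] at h3
    have h4 : ENNReal.ofReal (r + 2 / 3) ≤ ENNReal.ofReal 1 := by
      rw [ENNReal.ofReal_add hr0 (by norm_num), ENNReal.ofReal_one, ← h3, ← h23]
      gcongr
    rw [ENNReal.ofReal_le_ofReal_iff (by norm_num)] at h4
    linarith

end DiscreteLaw

/-! ### VC and LVC dimensions -/

section Dimensions

variable {X : Type u} {H : Set (X → Bool)} {S T : Set X}

theorem Shatters.mono {T' : Set X} (h : Shatters H T') (hT : T ⊆ T') : Shatters H T := by
  classical
  intro l
  obtain ⟨g, hg, hgl⟩ := h fun x => if hx : (x : X) ∈ T then l ⟨x, hx⟩ else false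
  refine ⟨g, hg, fun x => ?_⟩
  have := hgl ⟨x, hT x.2⟩
  simpa using this

theorem encard_le_of_shatters {d : ℕ} (hd : vcDim H S = d) (hT : T ⊆ S) (h : Shatters H T) :
    T.encard ≤ d := by
  rw [← hd]
  exact le_sSup ⟨T, hT, rfl, h⟩

/-- A finite supremum of a nonempty set in `ℕ∞` is attained, and smaller sets extend inside `S` to
size `l`. The case `l = 0` is excluded because it may be the supremum of the empty set. -/
theorem le_encard_and_forall_shatters {l : ℕ} (hl : lvcDim H S = l) (hl0 : l ≠ 0) :
    (l : ℕ∞) ≤ S.encard ∧ ∀ T : Set X, T ⊆ S → T.encard ≤ l → Shatters H T := by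
  set K : Set ℕ∞ := {k | k ≤ S.encard ∧ ∀ T : Set X, T ⊆ S → T.encard = k → Shatters H T}
  have hs : sSup K = l := hl
  have hmem : (l : ℕ∞) ∈ K := by
    rcases K.eq_empty_or_nonempty with hK | hK
    · rw [hK, sSup_empty, bot_eq_zero] at hs
      exact (hl0 (by exact_mod_cast hs.symm)).elim
    · have := hK.to_subtype
      rw [← hs]
      exact ENat.sSup_mem_of_nonempty_of_lt_top (by rw [hs]; exact ENat.natCast_lt_top l)
  refine ⟨hmem.1, fun T hT hTl => ?_⟩
  obtain ⟨T', hTT', hT'S, hT'⟩ := Set.exists_superset_subset_encard_eq hT hTl hmem.1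
  exact (hmem.2 T' hT'S hT').mono hTT'

theorem lvcDim_le_vcDim {d l : ℕ} (hd : vcDim H S = d) (hl : lvcDim H S = l) : l ≤ d := by
  rcases eq_or_ne l 0 with rfl | hl0
  · exact Nat.zero_le d
  obtain ⟨hS, hsh⟩ := le_encard_and_forall_shatters hl hl0
  obtain ⟨T, hTS, hT⟩ := Set.exists_subset_encard_eq hS
  have := encard_le_of_shatters hd hTS (hsh T hTS hT.le)
  rw [hT] at this
  exact_mod_cast this

theorem exists_injective_option_fin {n : ℕ} (h : (n : ℕ∞) < S.encard) :
    ∃ x : Option (Fin n) → X, Function.Injective x ∧ ∀ ω, x ω ∈ S := by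
  have h1 : ((n + 1 : ℕ) : ℕ∞) ≤ S.encard := by
    push_cast
    exact Order.add_one_le_of_lt h
  obtain ⟨T, hTS, hT⟩ := Set.exists_subset_encard_eq h1
  have hfin : T.Finite := Set.finite_of_encard_eq_coe hT
  have := hfin.fintype
  have hc : Fintype.card (Option (Fin n)) = Fintype.card T := by
    rw [Set.encard_eq_coe_toFinset_card, Set.toFinset_card] at hT
    rw [Fintype.card_option, Fintype.card_fin]
    exact_mod_cast hT.symm
  exact ⟨fun ω => (Fintype.equivOfCardEq hc ω : X),
    Subtype.val_injective.comp (Fintype.equivOfCardEq hc).injective,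
    fun ω => hTS (Fintype.equivOfCardEq hc ω).2⟩

end Dimensions

/-! ### The lower bound for testers -/

/-- Every labelling of finitely many distinct points extends to a measurable function. -/
theorem exists_measurable_extension {X : Type u} [MeasurableSpace X] [MeasurableSingletonClass X]
    {ι : Type} [Finite ι] {x : ι → X} (hx : Function.Injective x) (l : ι → Bool) :
    ∃ f : X → Bool, Measurable f ∧ ∀ i, f (x i) = l i := by
  classical
  refine ⟨fun y => decide (∃ i, x i = y ∧ l i = true), measurable_to_bool ?_, fun i => ?_⟩
  · refine ((Set.finite_range x).subset ?_).measurableSet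
    intro y hy
    obtain ⟨i, hi, -⟩ := of_decide_eq_true (by simpa using hy)
    exact ⟨i, hi⟩
  · rw [Bool.eq_iff_iff, decide_eq_true_iff]
    constructor
    · rintro ⟨j, hj, hl⟩
      rwa [← hx hj]
    · exact fun h => ⟨i, rfl, h⟩

section Tester

variable {X : Type u} [MeasurableSpace X] [MeasurableSingletonClass X] {H : Set (X → Bool)}
  {S : Set X} {d l : ℕ}

/-- The support consists of the points with `p i ≠ 0` and possibly the spare point `none`, which the
strict inequality in `hp` pays for; so it is shattered. -/
theorem distToClass_firstSuccess_eq_zero {n : ℕ} (hl : lvcDim H S = l) (hl0 : l ≠ 0)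
    {x : Option (Fin n) → X} (hxS : ∀ ω, x ω ∈ S) (f : X → Bool) {p : Fin n → ℝ}
    (h0 : ∀ i, 0 ≤ p i) (h1 : ∀ i, p i ≤ 1) (hp : Finset.card {i | p i ≠ 0} < l) :
    distToClass (discreteLaw (firstSuccess p) x) f H = 0 := by
  classical
  set s : Finset (Option (Fin n)) := Finset.insertNone {i | p i ≠ 0} with hs
  have hsh : Shatters H (x '' s) := by
    refine (le_encard_and_forall_shatters hl hl0).2 _ (by rintro _ ⟨ω, -, rfl⟩; exact hxS ω) ?_
    refine (Set.encard_image_le _ _).trans ?_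
    rw [Set.encard_coe_eq_coe_finsetCard, hs, Finset.card_insertNone]
    exact_mod_cast hp
  obtain ⟨h, hh, hf⟩ := hsh fun y => f y
  refine distToClass_discreteLaw_eq_zero (firstSuccess_nonneg h0 h1) hh fun ω hω => ?_
  refine hf ⟨x ω, ω, ?_, rfl⟩
  rw [Finset.mem_coe, hs]
  cases ω with
  | none => exact Finset.none_mem_insertNone
  | some i =>
    rw [Finset.some_mem_insertNone, Finset.mem_filter]
    refine ⟨Finset.mem_univ i, fun hi => hω ?_⟩
    rw [firstSuccess_some, hi, zero_mul]

/-- More than `d / 200` disagreements, each of mass at least `1 / (600 * d)`. -/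
theorem le_distToClass_firstSuccess (hd1 : 1 ≤ d) {x : Option (Fin (5 * d)) → X} {f : X → Bool}
    (hf : ∀ h ∈ H, d < 200 * Finset.card {i | f (x (some i)) ≠ h (x (some i))})
    {p : Fin (5 * d) → ℝ} (h1 : ∀ i, p i ≤ 1)
    (hlow : ∀ i, 1 / (300 * (d : ℝ)) ≤ p i) (hsum : ∑ i, p i < 1 / 2) :
    ENNReal.ofReal (1 / 120000) ≤ distToClass (discreteLaw (firstSuccess p) x) f H := by
  classical
  have hd0 : (0 : ℝ) < d := by exact_mod_cast hd1
  have h0 : ∀ i, 0 ≤ p i := fun i => le_trans (by positivity) (hlow i)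
  refine le_distToClass_discreteLaw (firstSuccess_nonneg h0 h1) fun h hh => ?_
  set s : Finset (Fin (5 * d)) := {i | f (x (some i)) ≠ h (x (some i))} with hs
  have hcard : (d : ℝ) < 200 * s.card := by exact_mod_cast hf h hh
  calc (1 / 120000 : ℝ) = d / 200 * (1 / (300 * d) * (1 / 2)) := by field_simp; norm_num
    _ ≤ s.card * (1 / (300 * d) * (1 / 2)) := by gcongr; linarith
    _ = ∑ i ∈ s, 1 / (300 * (d : ℝ)) * (1 / 2) := by rw [Finset.sum_const, nsmul_eq_mul]
    _ ≤ ∑ i ∈ s, firstSuccess p (some i) := Finset.sum_le_sum fun i _ => by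
        refine le_trans ?_ (mul_one_sub_sum_le_firstSuccess h0 h1 i)
        exact mul_le_mul (hlow i) (by linarith) (by norm_num) (h0 i)
    _ = ∑ ω ∈ s.map Function.Embedding.some, firstSuccess p ω := by
        rw [Finset.sum_map]; rfl
    _ ≤ ∑ ω with f (x ω) ≠ h (x ω), firstSuccess p ω := by
        refine Finset.sum_le_sum_of_subset_of_nonneg (fun ω hω => ?_)
          fun ω _ _ => firstSuccess_nonneg h0 h1 ω
        obtain ⟨i, hi, rfl⟩ := Finset.mem_map.1 hω
        have hi' := (Finset.mem_filter.1 hi).2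
        exact Finset.mem_filter.2 ⟨Finset.mem_univ _, hi'⟩

/-- The sampling error of the moment matching construction is at most `1 / 20`. -/
theorem moment_error_le {m q : ℕ} {y : ℝ} (he : 200 * (d : ℝ) ≤ Real.exp m)
    (hy : 0 ≤ y) (hq : 16 * y * q ≤ m) :
    ((5 * d : ℕ) : ℝ) * (2 * ((Real.exp 2)⁻¹) ^ (m + 2) * (1 + 2 * y * Real.exp 2) ^ q)
      ≤ 1 / 20 := by
  have he2 : Real.exp 2 ≤ 8 := by
    have h := Real.exp_one_lt_d9
    have h0 := Real.exp_pos 1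
    have : Real.exp 2 = Real.exp 1 * Real.exp 1 := by rw [← Real.exp_add]; norm_num
    rw [this]
    nlinarith
  have h1 : (1 + 2 * y * Real.exp 2) ^ q ≤ Real.exp m := by
    calc (1 + 2 * y * Real.exp 2) ^ q ≤ (Real.exp (16 * y)) ^ q := by
          gcongr
          rw [add_comm]
          refine le_trans ?_ (Real.add_one_le_exp _)
          nlinarith
      _ = Real.exp (16 * y * q) := by rw [← Real.exp_nat_mul]; ring_nf
      _ ≤ Real.exp m := Real.exp_le_exp.2 hq
  have h2 : ((Real.exp 2)⁻¹) ^ (m + 2) ≤ (Real.exp m)⁻¹ * (Real.exp m)⁻¹ := by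
    rw [← Real.exp_neg, ← Real.exp_neg, ← Real.exp_nat_mul, ← Real.exp_add]
    apply Real.exp_le_exp.2
    push_cast
    linarith
  have hE := Real.exp_pos (m : ℝ)
  calc _ ≤ ((5 * d : ℕ) : ℝ) * (2 * ((Real.exp m)⁻¹ * (Real.exp m)⁻¹) * Real.exp m) := by
        gcongr
    _ = 10 * d / Real.exp m := by push_cast; field_simp; ring
    _ ≤ 1 / 20 := by
        rw [div_le_div_iff₀ hE (by norm_num)]
        linarith

/-- A tester that sees at most `q` labels cannot exist if `900 m q ≤ l`, where `m` is at least of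
the order of `log d` and `m²` is at most of the order of `l`. -/
theorem not_isTolerantTester {q m : ℕ} {ε₀ ε₁ : ℝ} (hd : vcDim H S = d) (hl : lvcDim H S = l)
    (hS : 5 * (d : ℕ∞) < S.encard) (hd1 : 1 ≤ d) (hl0 : l ≠ 0) (hm : 1 ≤ m)
    (he : 200 * (d : ℝ) ≤ Real.exp m) (hml : 60 * (m : ℝ) ^ 2 ≤ l)
    (hq : 900 * (m : ℝ) * q ≤ l) (hε₁ : ε₁ ≤ 1 / 120000) (A : RandomizedAlgorithm.{u, v} X q) :
    ¬ A.IsTolerantTester H ε₀ ε₁ := by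
  classical
  intro hA
  obtain ⟨x, hx, hxS⟩ := exists_injective_option_fin (n := 5 * d) (S := S) (by exact_mod_cast hS)
  have hxs : Function.Injective fun i => x (some i) := hx.comp (Option.some_injective _)
  obtain ⟨lab, hlab⟩ := exists_labelling_far H hd1 (fun i => x (some i)) fun s hs => by
    have hsh : Shatters H ((fun i => x (some i)) '' s) := fun lb => by
      obtain ⟨h, hh, hhl⟩ := hs fun i => if hi : i ∈ s then lb ⟨x (some i), i, hi, rfl⟩ else false
      refine ⟨h, hh, ?_⟩
      rintro ⟨_, i, hi, rfl⟩
      have := hhl i hi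
      rwa [dif_pos (Finset.mem_coe.1 hi)] at this
    have := encard_le_of_shatters hd (by rintro _ ⟨i, -, rfl⟩; exact hxS _) hsh
    rw [hxs.encard_image, Set.encard_coe_eq_coe_finsetCard] at this
    exact_mod_cast this
  obtain ⟨f, hfm, hf⟩ := exists_measurable_extension hxs lab
  obtain ⟨φ, hφ0, hφ1, hφ⟩ := hA.exists_sample_test hx hfm
  have hld : (l : ℝ) ≤ d := by exact_mod_cast lvcDim_le_vcDim hd hl
  have hl1 : (0 : ℝ) < l := by exact_mod_cast Nat.pos_of_ne_zero hl0
  have hd0 : (0 : ℝ) < d := by linarith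
  -- Under the first prior the expected number of nonzero weights is at most `5 * d * (5 / b) = l /
  -- 20`, so Markov's inequality fails with probability at most `1 / 20`.
  set b : ℝ := 500 * d / l with hb
  have hb2 : 2 ≤ b := by
    rw [hb, le_div_iff₀ hl1]; linarith
  obtain ⟨J, _, u, a, a', ha, ha', ha1, ha1', hu0, hub, hmom, hu1, hau, hau'⟩ :=
    exists_moment_matching m hm b hb2
  -- The scale `1 / (300 * d)` makes the expected total weight under the second prior at most `1 /
  -- 40`, so it reaches `1 / 2` with probability at most `1 / 20`.
  set v : J → ℝ := fun j => u j * (1 / (300 * d)) with hv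
  set y : ℝ := 160 / 3 * (m : ℝ) ^ 2 / l with hy
  have hv0 : ∀ j, 0 ≤ v j := fun j => mul_nonneg (hu0 j) (by positivity)
  have hvy : ∀ j, v j ≤ y := fun j => by
    calc v j ≤ 32 * b * m ^ 2 * (1 / (300 * d)) := by simp only [hv]; gcongr; exact hub j
      _ = y := by rw [hy, hb]; field_simp; norm_num
  have hy0 : 0 ≤ y := by positivity
  have hy1 : y ≤ 1 := by
    rw [hy, div_le_one hl1]
    nlinarith [sq_nonneg (m : ℝ)]
  have hv1 : ∀ j, v j ≤ 1 := fun j => (hvy j).trans hy1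
  have hyq : 16 * y * q ≤ m := by
    have hm0 : (0 : ℝ) ≤ m := m.cast_nonneg
    calc 16 * y * q = (2560 / 3 * m * q) * m / l := by rw [hy]; ring
      _ ≤ l * m / l := by
        gcongr
        have : (0 : ℝ) ≤ m * q := by positivity
        linarith
      _ = m := by field_simp
  have hmomv : ∀ k < m + 2, ∑ j, a j * v j ^ k = ∑ j, a' j * v j ^ k := fun k hk => by
    simp only [hv, mul_pow, ← mul_assoc]
    rw [← Finset.sum_mul, ← Finset.sum_mul, hmom k hk]
  set P : (Fin (5 * d) → J) → Option (Fin (5 * d)) → ℝ :=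
    fun σ => firstSuccess fun i => v (σ i) with hP
  have hP0 : ∀ σ ω, 0 ≤ P σ ω := fun σ ω =>
    firstSuccess_nonneg (fun i => hv0 _) (fun i => hv1 _) ω
  have hP1 : ∀ σ, ∑ ω, P σ ω = 1 := fun σ => sum_firstSuccess _
  set Ψ : (Fin (5 * d) → J) → ℝ := fun σ => ∑ s, φ s * ∏ t, P σ (s t) with hΨ
  have hΨ0 : ∀ σ, 0 ≤ Ψ σ := fun σ => Finset.sum_nonneg fun s _ =>
    mul_nonneg (hφ0 s) (Finset.prod_nonneg fun t _ => hP0 _ _)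
  have hΨ1 : ∀ σ, Ψ σ ≤ 1 := fun σ => by
    calc Ψ σ ≤ ∑ s : Fin q → Option (Fin (5 * d)), ∏ t, P σ (s t) := Finset.sum_le_sum fun s _ =>
          mul_le_of_le_one_left (Finset.prod_nonneg fun t _ => hP0 _ _) (hφ1 s)
      _ = 1 := by
          rw [← Fintype.piFinset_univ, ← Finset.prod_univ_sum]
          simp [hP1]
  have hclose : |prodExpect a Ψ - prodExpect a' Ψ| ≤ 1 / 20 :=
    (abs_prodExpect_firstSuccess_sub_le ha ha1 ha' ha1' hv0 hvy hy0 hy1 hmomv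
      (fun s => by rw [abs_of_nonneg (hφ0 s)]; exact hφ1 s)
      (Real.one_le_exp (by norm_num : (0 : ℝ) ≤ 2))).trans (moment_error_le he hy0 hyq)
  have hcard : ∀ σ : Fin (5 * d) → J, ∑ i, (if u (σ i) = 0 then (0 : ℝ) else 1)
      = (Finset.card {i | v (σ i) ≠ 0} : ℝ) := fun σ => by
    rw [Finset.card_filter, Nat.cast_sum]
    refine Finset.sum_congr rfl fun i _ => ?_
    have : v (σ i) = 0 ↔ u (σ i) = 0 := by
      simp only [hv, mul_eq_zero]
      exact or_iff_left (by positivity)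
    by_cases h : u (σ i) = 0 <;> simp [this, h]
  have hclosed : 19 / 30 ≤ prodExpect a Ψ := by
    have hG := one_sub_le_prodExpect_sum_lt (n := 5 * d) ha ha1
      (g := fun j => if u j = 0 then 0 else 1) (fun j => by positivity) hl1
    have hle : ((5 * d : ℕ) : ℝ) * (∑ j, a j * if u j = 0 then 0 else 1) / l ≤ 1 / 20 := by
      calc _ ≤ ((5 * d : ℕ) : ℝ) * (5 / b) / l := by gcongr
        _ = 1 / 20 := by rw [hb]; push_cast; field_simp; norm_num
    have h2 : prodExpect a (fun σ : Fin (5 * d) → J => 2 / 3 *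
        if ∑ i, (if u (σ i) = 0 then (0 : ℝ) else 1) < l then 1 else 0) ≤ prodExpect a Ψ := by
      refine prodExpect_mono ha fun σ _ => ?_
      split_ifs with h
      · rw [hcard σ] at h
        have hz := distToClass_firstSuccess_eq_zero hl hl0 hxS f (p := fun i => v (σ i))
          (fun i => hv0 _) (fun i => hv1 _) (by exact_mod_cast h)
        rw [mul_one]
        exact (hφ (P σ) (hP0 σ) (hP1 σ)).1 (by rw [hP, hz]; exact zero_le)
      · rw [mul_zero]; exact hΨ0 σ
    rw [prodExpect_const_mul] at h2
    linarith
  have hfar : prodExpect a' Ψ ≤ 23 / 60 := by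
    have hG := one_sub_le_prodExpect_sum_lt (n := 5 * d) ha' ha1' hv0
      (by norm_num : (0 : ℝ) < 1 / 2)
    have hle : ((5 * d : ℕ) : ℝ) * (∑ j, a' j * v j) / (1 / 2) ≤ 1 / 20 := by
      simp only [hv, ← mul_assoc]
      rw [← Finset.sum_mul]
      calc _ ≤ ((5 * d : ℕ) : ℝ) * (3 / 2 * (1 / (300 * d))) / (1 / 2) := by gcongr
        _ = 1 / 20 := by push_cast; field_simp; norm_num
    -- Acceptance is at most `1 / 3` on the good event and at most `1` off it. The averages `19 /
    -- 30` and `23 / 60` then differ by `1 / 4`, more than the allowed `1 / 20`.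
    have h2 : prodExpect a' Ψ ≤ prodExpect a' (fun σ : Fin (5 * d) → J => 4 / 3 -
        if ∑ i, v (σ i) < 1 / 2 then 1 else 0) := by
      refine prodExpect_mono ha' fun σ hσ => ?_
      split_ifs with h
      · have hz := le_distToClass_firstSuccess (H := H) (f := f) (x := x) hd1 (fun h hh => by
          simpa only [hf] using hlab h hh) (p := fun i => v (σ i)) (fun i => hv1 _) (fun i => by
            have := hu1 _ (hσ i)
            simp only [hv]
            exact le_mul_of_one_le_left (by positivity) this) h
        have := (hφ (P σ) (hP0 σ) (hP1 σ)).2 ((ENNReal.ofReal_le_ofReal hε₁).trans hz)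
        norm_num
        linarith
      · linarith [hΨ1 σ]
    rw [prodExpect_sub, prodExpect_const ha1'] at h2
    linarith
  have := (abs_le.1 hclose).2
  linarith

end Tester

/-! ### Choice of the parameters -/

theorem log_sq_le_rpow_mul_sqrt_log {t : ℝ} (ht : 1 ≤ t) :
    Real.log t ^ 2 ≤ 4 * (t ^ (3 / 4 : ℝ) * Real.sqrt (Real.log t)) := by
  have ht0 : 0 ≤ t := by linarith
  set s := Real.sqrt (Real.log t) with hs
  set r := t ^ (1 / 4 : ℝ) with hr
  have hs0 : 0 ≤ s := Real.sqrt_nonneg _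
  have hr0 : 0 ≤ r := Real.rpow_nonneg ht0 _
  have hs2 : s ^ 2 = Real.log t := Real.sq_sqrt (Real.log_nonneg ht)
  have hr2 : t ^ (1 / 2 : ℝ) = r ^ 2 := by
    rw [hr, ← Real.rpow_natCast, ← Real.rpow_mul ht0]; norm_num
  have hr3 : t ^ (3 / 4 : ℝ) = r ^ 3 := by
    rw [hr, ← Real.rpow_natCast, ← Real.rpow_mul ht0]; norm_num
  have hlog := Real.log_le_rpow_div ht0 (by norm_num : (0 : ℝ) < 1 / 2)
  rw [hr2, ← hs2] at hlog
  have hsr : s ≤ 3 / 2 * r := by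
    apply le_of_sq_le_sq _ (by positivity)
    nlinarith [sq_nonneg r]
  rw [hr3, ← hs2]
  calc (s ^ 2) ^ 2 = s ^ 3 * s := by ring
    _ ≤ (3 / 2 * r) ^ 3 * s := by gcongr
    _ ≤ 4 * (r ^ 3 * s) := by
        have : 0 ≤ r ^ 3 * s := by positivity
        nlinarith

theorem mainTheorem2 :
    ∃ C > (0 : ℝ), ∃ c > (0 : ℝ), ∃ ε > (0 : ℝ),
      ∀ (X : Type u) [MeasurableSpace X] [MeasurableSingletonClass X]
        (H : Set (X → Bool)) (S : Set X) (d l : ℕ),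
        vcDim H S = d → lvcDim H S = l → 2 ≤ d →
        5 * (d : ℕ∞) < S.encard →
        C * (d : ℝ) ^ (3 / 4 : ℝ) * Real.sqrt (Real.log d) ≤ l →
        ∀ ε₀ ε₁ : ℝ, 0 < ε₁ → ε₁ ≤ ε → 0 ≤ ε₀ → ε₀ < ε₁ →
          ENNReal.ofReal (c * ((l : ℝ) ^ 2 / (d * Real.log d))) ≤
            (qTol.{u, v} H ε₀ ε₁ : ℝ≥0∞) := by
  refine ⟨30000, by norm_num, 1 / 9900, by norm_num, 1 / 120000, by norm_num, ?_⟩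
  intro X _ _ H S d l hd hl hd2 hS hC ε₀ ε₁ _ hε₁ _ _
  by_contra hlt
  rw [not_le] at hlt
  have hqtop : qTol.{u, v} H ε₀ ε₁ < ⊤ := by
    rw [lt_top_iff_ne_top]
    rintro htop
    rw [htop] at hlt
    simp at hlt
  obtain ⟨q, hq, A, hA⟩ : qTol.{u, v} H ε₀ ε₁ ∈ {n : ℕ∞ | ∃ q : ℕ, n = q ∧
      ∃ A : RandomizedAlgorithm.{u, v} X q, A.IsTolerantTester H ε₀ ε₁} := by
    refine csInf_mem (Set.nonempty_iff_ne_empty.2 fun hempty => ?_)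
    rw [qTol, hempty, sInf_empty] at hqtop
    exact lt_irrefl _ hqtop
  rw [hq] at hlt
  have hdR : (2 : ℝ) ≤ d := by exact_mod_cast hd2
  have hd0 : (0 : ℝ) < d := by linarith
  have hlog : 1 / 2 ≤ Real.log d := by
    have := Real.log_two_gt_d9
    have := Real.log_le_log (by norm_num) hdR
    linarith
  have hlog0 : 0 < Real.log d := by linarith
  have hl0 : l ≠ 0 := by
    rintro rfl
    have : 0 < 30000 * (d : ℝ) ^ (3 / 4 : ℝ) * Real.sqrt (Real.log d) := by positivity
    norm_num at hC
    linarith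
  have hld : (l : ℝ) ≤ d := by exact_mod_cast lvcDim_le_vcDim hd hl
  have hqr : (q : ℝ) < 1 / 9900 * ((l : ℝ) ^ 2 / (d * Real.log d)) := by
    have h : ((q : ℝ≥0∞)) < ENNReal.ofReal (1 / 9900 * ((l : ℝ) ^ 2 / (d * Real.log d))) := by
      exact_mod_cast hlt
    rw [← ENNReal.ofReal_natCast, ENNReal.ofReal_lt_ofReal_iff'] at h
    exact h.1
  -- Here `l ≤ d` weakens the bound to the form `q ≲ l / log d`.
  have hql : 9900 * (Real.log d * q) ≤ l := by
    have h1 : (l : ℝ) ^ 2 / (d * Real.log d) ≤ l / Real.log d := by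
      rw [div_le_div_iff₀ (by positivity) hlog0]
      calc (l : ℝ) ^ 2 * Real.log d = l * (l * Real.log d) := by ring
        _ ≤ l * (d * Real.log d) := by gcongr
    have h2 : (q : ℝ) ≤ 1 / 9900 * (l / Real.log d) := by linarith
    calc 9900 * (Real.log d * q) ≤ 9900 * (Real.log d * (1 / 9900 * (l / Real.log d))) := by gcongr
      _ = l := by field_simp
  have hm9 : 9 * Real.log d ≤ ⌈9 * Real.log d⌉₊ := Nat.le_ceil _
  have hm11 : (⌈9 * Real.log d⌉₊ : ℝ) ≤ 11 * Real.log d := by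
    have := Nat.ceil_lt_add_one (by positivity : 0 ≤ 9 * Real.log d)
    linarith
  -- The factor `9` gives `exp m ≥ d ^ 9 ≥ 200 * d`, as `d ^ 8 ≥ 256`. Rounding up costs at most `1
  -- ≤ 2 * log d`, whence `11`, and `9900 = 900 * 11`.
  refine not_isTolerantTester (m := ⌈9 * Real.log d⌉₊) hd hl hS (by omega) hl0
    (Nat.ceil_pos.2 (by positivity)) ?_ ?_ ?_ hε₁ A hA
  · calc 200 * (d : ℝ) ≤ 2 ^ 8 * d := by gcongr; norm_num
      _ ≤ (d : ℝ) ^ 8 * d := by gcongr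
      _ = Real.exp (9 * Real.log d) := by
          rw [mul_comm 9, Real.exp_mul, Real.exp_log hd0]
          norm_cast
      _ ≤ _ := Real.exp_le_exp.2 hm9
  · have h1 := log_sq_le_rpow_mul_sqrt_log (by linarith : (1 : ℝ) ≤ d)
    have h2 : (⌈9 * Real.log d⌉₊ : ℝ) ^ 2 ≤ (11 * Real.log d) ^ 2 := by gcongr
    have h3 : 0 ≤ (d : ℝ) ^ (3 / 4 : ℝ) * Real.sqrt (Real.log d) := by positivity
    nlinarith
  · calc 900 * (⌈9 * Real.log d⌉₊ : ℝ) * q ≤ 900 * (11 * Real.log d) * q := by gcongr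
      _ = 9900 * (Real.log d * q) := by ring
      _ ≤ l := hql
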